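/- Let $K,\kappa,i$ be positive integers and $\epsilon\in\{0,1\}$ with $K>2$, $K=2\kappa-\epsilon$ and $1\le i\le\kappa$, and let $n\ge 0$ be an integer. A jagged partition of $n$ is a finite sequence $(n_1,\dots,n_m)$ of non-negative integers of arbitrary length $m\ge 0$ with $\sum_j n_j=n$, such that $n_j\ge n_{j+1}-1$ and $n_j\ge n_{j+2}$ whenever these entries exist, and $n_m\ge 1$ if $m\ge 1$. It is $K$-restricted if for every $1\le j\le m-K+1$ $$n_j\ge n_{j+K-1}+1\qquad\text{or}\qquad n_j=n_{j+1}-1=n_{j+K-2}+1=n_{j+K-1}.$$ Let $J_{K,i}(n)$ be the number of $K$-restricted jagged partitions of $n$ (of any length) containing at most $i-1$ pairs $01$, that is, with at most $i-1$ indices $j$ such that $(n_j,n_{j+1})=(0,1)$. For a partition $\lambda=(\lambda_1\ge\lambda_2\ge\cdots)$ with conjugate $\lambda'$, let $d$ be the largest integer with $\lambda_d\ge d$ ($d=0$ for the empty partition). The successive ranks of $\lambda$ are the integers $SR(j)=s_j-t_j$ for $1\le j\le d$, where $s_j=\lambda_j-j$ and $t_j=\lambda'_j-j$. Let $R_{K,i}(2n)$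 be the number of partitions of $2n$ all of whose successive ranks are odd and lie in the interval $[3-2i,\,2K-1-2i]$. Then $J_{K,i}(n)=R_{K,i}(2n)$. -/

import Mathlib

/-- A jagged partition `(n_1, …, n_m)`, as a list of natural numbers of arbitrary length `m`
(positions are counted from `0`):
`n_j ≥ n_{j+1} - 1`, `n_j ≥ n_{j+2}` and, if the sequence is nonempty, `n_m ≥ 1`. -/
structure IsJagged (l : List ℕ) : Prop where
  step_one : ∀ (j : ℕ) (h : j + 1 < l.length), l[j + 1] ≤ l[j] + 1
  step_two : ∀ (j : ℕ) (h : j + 2 < l.length), l[j + 2] ≤ l[j]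
  last_pos : ∀ h : l ≠ [], 1 ≤ l.getLast h

/-- The `K`-restriction (used for `K ≥ 2`): for every `j` for which `n_{j+K-1}` exists,
`n_j ≥ n_{j+K-1} + 1` or `n_j = n_{j+1} - 1 = n_{j+K-2} + 1 = n_{j+K-1}`. -/
def IsRestricted (K : ℕ) (l : List ℕ) : Prop :=
  ∀ (j : ℕ) (_ : 2 ≤ K) (_ : j + (K - 1) < l.length),
    l[j + (K - 1)] + 1 ≤ l[j] ∨
      (l[j] + 1 = l[j + 1] ∧ l[j] = l[j + (K - 2)] + 1 ∧ l[j] = l[j + (K - 1)])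

/-- The number of pairs `01` in a sequence: the number of positions `j` with
`n_j = 0` and `n_{j+1} = 1`. -/
def pairCount (l : List ℕ) : ℕ :=
  ((Finset.range l.length).filter (fun j => l[j]? = some 0 ∧ l[j + 1]? = some 1)).card

/-- The `K`-restricted jagged partitions of `n` (of any length) containing at most `i - 1`
pairs `01`. -/
def jaggedSet (K i n : ℕ) : Set (List ℕ) :=
  {l | IsJagged l ∧ IsRestricted K l ∧ l.sum = n ∧ pairCount l ≤ i - 1}

/-- Dropping the first two entries of a jagged partition leaves a jagged partition. -/
theorem IsJagged.drop_two {a b : ℕ} {l : List ℕ} (h : IsJagged (a :: b :: l)) : IsJagged l where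
  step_one j hj := by
    exact h.step_one (j + 2) (by simp only [List.length_cons]; omega)
  step_two j hj := by
    exact h.step_two (j + 2) (by simp only [List.length_cons]; omega)
  last_pos hl := by
    have := h.last_pos (by simp)
    simpa [List.getLast_cons, hl] using this

/-- A jagged partition does not start with two zeros. -/
theorem not_isJagged_zero_zero : ∀ l : List ℕ, ¬ IsJagged (0 :: 0 :: l)
  | [], h => by simpa using h.last_pos (by simp)
  | [c], h => by
    have h1 := h.step_two 0 (by simp)
    have h2 := h.last_pos (by simp)
    simp at h1 h2
    omega
  | c :: d :: l, h => by
    have h1 := h.step_two 0 (by simp)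
    have h2 := h.step_two 1 (by simp)
    simp at h1 h2
    subst h1 h2
    exact not_isJagged_zero_zero l h.drop_two

/-- The length of a jagged partition is at most twice its weight. -/
theorem IsJagged.length_le : ∀ {l : List ℕ}, IsJagged l → l.length ≤ 2 * l.sum
  | [], _ => by simp
  | [a], h => by
    have := h.last_pos (by simp)
    simp at this ⊢
    omega
  | a :: b :: l, h => by
    have ih := h.drop_two.length_le
    have : 1 ≤ a + b := by
      by_contra hc
      obtain ⟨rfl, rfl⟩ : a = 0 ∧ b = 0 := by omega
      exact not_isJagged_zero_zero l h
    simp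
    omega

/-- There are finitely many jagged partitions of `n`, so that counting them with `Set.ncard`
is meaningful. -/
theorem jaggedSet_finite (K i n : ℕ) : (jaggedSet K i n).Finite := by
  refine Set.Finite.subset
    (Set.Finite.image (List.map (Fin.val : Fin (n + 1) → ℕ))
      (List.finite_length_le (Fin (n + 1)) (2 * n))) ?_
  rintro l ⟨hj, -, hs, -⟩
  have hlt : ∀ x ∈ l, x < n + 1 := fun x hx => by
    have := List.le_sum_of_mem hx
    omega
  refine ⟨l.pmap Fin.mk hlt, ?_, ?_⟩
  · have := hj.length_le
    simp
    omega
  · simp [List.map_pmap]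

/-- `J_{K,i}(n)`: the number of `K`-restricted jagged partitions of `n`, of any length,
containing at most `i - 1` pairs `01`. -/
noncomputable def jaggedCount (K i n : ℕ) : ℕ :=
  (jaggedSet K i n).ncard

/-- The `j`-th largest part `λ_j` of a partition, `j ≥ 1` (it is `0` when `j` exceeds the number
of parts). -/
def partAt {N : ℕ} (p : N.Partition) (j : ℕ) : ℕ :=
  (p.parts.sort (· ≥ ·)).getD (j - 1) 0

/-- The `j`-th part `λ'_j` of the conjugate partition, `j ≥ 1`: the number of parts of `λ` that
are at least `j`. -/
def conjPartAt {N : ℕ} (p : N.Partition) (j : ℕ) : ℕ :=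
  (p.parts.filter (fun x => j ≤ x)).card

/-- The largest `d` with `λ_d ≥ d` (`0` for the empty partition). Any such `d` is at most `N`,
because `λ_d ≤ N`. -/
def durfeeSize {N : ℕ} (p : N.Partition) : ℕ :=
  Nat.findGreatest (fun d => d ≤ partAt p d) N

/-- The upper entries `s_j = λ_j - j` of the Frobenius symbol. -/
def frobeniusTop {N : ℕ} (p : N.Partition) (j : ℕ) : ℤ :=
  (partAt p j : ℤ) - j

/-- The lower entries `t_j = λ'_j - j` of the Frobenius symbol. -/
def frobeniusBot {N : ℕ} (p : N.Partition) (j : ℕ) : ℤ :=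
  (conjPartAt p j : ℤ) - j

/-- The successive ranks `SR(j) = s_j - t_j`, for `1 ≤ j ≤ d`. -/
def successiveRank {N : ℕ} (p : N.Partition) (j : ℕ) : ℤ :=
  frobeniusTop p j - frobeniusBot p j

/-- `R_{K,i}(N)`: the number of partitions of `N` all of whose successive ranks are odd and lie
in the interval `[3 - 2i, 2K - 1 - 2i]`. -/
noncomputable def rankCount (K i N : ℕ) : ℕ :=
  Nat.card {p : N.Partition // ∀ j : ℕ, 1 ≤ j → j ≤ durfeeSize p →
    Odd (successiveRank p j) ∧
      successiveRank p j ∈ Set.Icc (3 - 2 * (i : ℤ)) (2 * (K : ℤ) - 1 - 2 * (i : ℤ))}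

/-! A jagged partition splits into runs, read from high to low position: the run at an even position
`p` repeats `p / 2`, the run at an odd `p` repeats the pair `p / 2, p / 2 + 1`. The run lengths
`f_p` determine it; they are even at odd `p`, satisfy `∑ p * f_p = 2n`, and `f_1 / 2` counts the
pairs 01. The `K`-restriction becomes Gordon's condition `f_p + f_{p+1} ≤ K - 1`. On the other side,
a partition is its Frobenius symbol, and a rank `s - t` is odd exactly when the hook length `s + t +
1` is even.

What remains is a Gordon-type identity with parity, `encard_gordonSet_eq_frobeniusSet`, used with `k
= K`, `a = 2i - 1`, `c = 0`. Both families are refined by a size `d` (dominoes, columns) and a flag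
`u` (a domino protrudes below position 1; an upper entry vanishes), and both obey one recursion. For
`u = false`, moving every domino down, or lowering every upper entry, costs weight `d`, flips `c`
and replaces `a` by `a + 1`. For `u = true`, the dominoes again move down and one unit leaves the
list, while in the symbol the lower entries drop; here `a` decreases, and one domino, or one column
`(0, 0)`, may disappear, which forces `c = 1`. At the boundary `a = k`, the parameters `k` and `k +
1` give equal counts: by Gordon's condition on one side, by conjugation on the other. At `a = 1`
there is nothing with `u = true`. Induction on the weight finishes. -/

/-! ### Frequency lists and domino moves -/

/-- Whether the first entry is the upper end of a domino when the support of a frequency list is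
covered greedily by dominoes, starting from its largest position. -/
def topHead : List ℕ → Bool
  | [] => false
  | x :: l => decide (0 < x) && !topHead l

/-- The number of dominoes in the greedy cover of the support of a frequency list. -/
def topCount : List ℕ → ℕ
  | [] => 0
  | x :: l => (topHead (x :: l)).toNat + topCount l

/-- The weight `∑ j, (p + j) * f_j` of a frequency list whose first position is `p`. -/
def weightFrom : ℕ → List ℕ → ℕ
  | _, [] => 0
  | p, x :: l => p * x + weightFrom (p + 1) l

/-- Gordon's condition: neighbouring frequencies add up to at most `k - 1`. -/
def Gordon (k : ℕ) : List ℕ → Prop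
  | [] => True
  | x :: l => x + l.headD 0 + 1 ≤ k ∧ Gordon k l

/-- In each domino of the greedy cover, the frequency at the odd position is `c` modulo `2`. -/
def ParityFrom (c : ℕ) : ℕ → List ℕ → Prop
  | _, [] => True
  | p, x :: l =>
    (p % 2 = 1 → (topHead (x :: l) = true ∨ topHead l = true) → x % 2 = c) ∧
      ParityFrom c (p + 1) l

/-- Cover the support greedily by dominoes, starting from the smallest position, and move one unit
upwards in each domino. If the flag is set, a domino already starts just before the list. -/
def raise : Bool → List ℕ → List ℕ
  | b, [] => [b.toNat]
  | true, y :: l => (y + 1) :: raise false l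
  | false, 0 :: l => 0 :: raise false l
  | false, (x + 1) :: l => x :: raise true l

/-- Move one unit downwards in each domino of the greedy cover from above, and drop the last
position. -/
def lower : List ℕ → List ℕ
  | [] => []
  | [_] => []
  | x :: y :: l =>
    (x - (topHead (x :: y :: l)).toNat + (topHead (y :: l)).toNat) :: lower (y :: l)

/-- The dominoes moved by `raise`, chosen from below, are the ones that the cover from above finds
afterwards: a raised upper end is positive and is never followed by another upper end. This is what
makes `lower` undo `raise`. -/
theorem topHead_raise : ∀ (b : Bool) (l : List ℕ), topHead (raise b l) = b
  | b, [] => by cases b <;> simp [raise, topHead]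
  | true, y :: l => by simp [raise, topHead, topHead_raise false l]
  | false, 0 :: l => by simp [raise, topHead]
  | false, (x + 1) :: l => by simp [raise, topHead, topHead_raise true l]

theorem length_raise : ∀ (b : Bool) (l : List ℕ), (raise b l).length = l.length + 1
  | b, [] => by simp [raise]
  | true, y :: l => by simp [raise, length_raise false l]
  | false, 0 :: l => by simp [raise, length_raise false l]
  | false, (x + 1) :: l => by simp [raise, length_raise true l]

theorem raise_ne_nil (b : Bool) (l : List ℕ) : raise b l ≠ [] := by
  intro h
  have := length_raise b l
  simp [h] at this

theorem lower_cons {x : ℕ} {l : List ℕ} (h : l ≠ []) :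
    lower (x :: l) = (x - (topHead (x :: l)).toNat + (topHead l).toNat) :: lower l := by
  cases l with
  | nil => exact absurd rfl h
  | cons y l => rfl

theorem lower_raise : ∀ (b : Bool) (l : List ℕ), lower (raise b l) = l
  | b, [] => by simp [raise, lower]
  | true, y :: l => by
    simp [raise, lower_cons (raise_ne_nil _ _), lower_raise false l, topHead, topHead_raise]
  | false, 0 :: l => by
    simp [raise, lower_cons (raise_ne_nil _ _), lower_raise false l, topHead, topHead_raise]
  | false, (x + 1) :: l => by
    simp [raise, lower_cons (raise_ne_nil _ _), lower_raise true l, topHead, topHead_raise]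

theorem raise_injective (b : Bool) : Function.Injective (raise b) :=
  Function.LeftInverse.injective (lower_raise b)

/-- `lower` forgets the last frequency, which `raise` can restore only if it is at most 1. The
weight bound ensures this, since two units at the last position `p + f.length` would already be too
heavy. -/
theorem raise_lower : ∀ (p : ℕ) (f : List ℕ), f ≠ [] → weightFrom (p + 1) f ≤ p + f.length →
    raise (topHead f) (lower f) = f
  | p, [], h, _ => absurd rfl h
  | p, [x], _, h => by
    have hx : x ≤ 1 := by
      simp only [weightFrom, List.length_singleton] at h
      by_contra hc
      have : (p + 1) * 2 ≤ (p + 1) * x := Nat.mul_le_mul_left _ (by omega)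
      omega
    interval_cases x <;> simp [topHead, lower, raise]
  | p, x :: y :: l, _, h => by
    have ih := raise_lower (p + 1) (y :: l) (by simp) (by
      simp only [weightFrom, List.length_cons] at h ⊢
      omega)
    rw [lower_cons (by simp)]
    cases hb : topHead (y :: l) <;> rw [hb] at ih
    · rcases x with _ | x
      · simp [topHead, raise, ih]
      · have : topHead ((x + 1) :: y :: l) = true := by
          rw [topHead, hb]; simp
        simp [this, raise, ih]
    · have : topHead (x :: y :: l) = false := by
        rw [topHead, hb]; simp
      simp [this, raise, ih]

theorem weightFrom_raise : ∀ (b : Bool) (l : List ℕ) (p : ℕ),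
    weightFrom (p + 1) (raise b l) =
      weightFrom (p + 1) l + topCount (raise b l) + p * b.toNat
  | b, [], p => by cases b <;> simp [raise, weightFrom, topCount, topHead, add_comm]
  | true, y :: l, p => by
    simp [raise, weightFrom, topCount, topHead, topHead_raise, weightFrom_raise false l (p + 1)]
    ring
  | false, 0 :: l, p => by
    simp [raise, weightFrom, topCount, topHead, weightFrom_raise false l (p + 1)]
  | false, (x + 1) :: l, p => by
    simp [raise, weightFrom, topCount, topHead, topHead_raise, weightFrom_raise true l (p + 1)]
    ring

/-- A block of `m` consecutive support positions needs `⌈m / 2⌉` dominoes, from whichever end the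
cover starts. -/
theorem topCount_raise_false : ∀ l : List ℕ, topCount (raise false l) = topCount l
  | [] => by simp [raise, topCount, topHead]
  | 0 :: l => by simp [raise, topCount, topHead, topCount_raise_false l]
  | [x + 1] => by simp [raise, topCount, topHead]
  | (x + 1) :: y :: l => by
    simp only [raise, topCount, topCount_raise_false l]
    cases h : topHead l <;> simp [topHead, topHead_raise, h]
    by_cases hy : 0 < y <;> simp [hy]

/-- The incoming domino covers the head, so the initial block of length `m` leaves `m - 1`
positions. For odd `m` (that is, `topHead l`) the total is unchanged; for even `m`, including `0`,
one domino is added. -/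
theorem topCount_raise_true (l : List ℕ) :
    topCount (raise true l) = topCount l + (!topHead l).toNat := by
  cases l with
  | nil => simp [raise, topCount, topHead]
  | cons x l =>
    have : topHead ((x + 1) :: raise false l) = true := by simp [topHead, topHead_raise]
    simp only [raise, topCount, this, topCount_raise_false]
    cases topHead (x :: l) <;> simp <;> omega

theorem headD_raise_true (l : List ℕ) : (raise true l).headD 0 = l.headD 0 + 1 := by
  cases l <;> simp [raise]

theorem headD_raise_false : ∀ l : List ℕ, (raise false l).headD 0 = l.headD 0 - 1
  | [] => by simp [raise]
  | 0 :: l => by simp [raise]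
  | (x + 1) :: l => by simp [raise]

/-- Sums inside a domino and between adjacent dominoes do not change. If the position above a raised
upper end is empty, the old sum of its domino supplies the bound; only a domino entering from before
the list lacks such a sum, whence the extra condition. -/
theorem gordon_raise {k : ℕ} (hk : 1 ≤ k) : ∀ (b : Bool) (l : List ℕ),
    Gordon k (raise b l) ↔ Gordon k l ∧ (b = true → l.headD 0 + 2 ≤ k)
  | b, [] => by cases b <;> simp [raise, Gordon]; omega
  | true, y :: l => by
    have ih := gordon_raise hk false l
    simp only [raise, Gordon, headD_raise_false, ih]
    simp only [List.headD_cons]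
    constructor
    · rintro ⟨h1, h2, -⟩
      refine ⟨⟨by omega, h2⟩, fun _ => by omega⟩
    · rintro ⟨⟨h1, h2⟩, h3⟩
      have := h3 trivial
      exact ⟨by omega, h2, by simp⟩
  | false, 0 :: l => by
    have ih := gordon_raise hk false l
    simp only [raise, Gordon, headD_raise_false, ih]
    constructor
    · rintro ⟨h1, h2, -⟩
      refine ⟨⟨?_, h2⟩, by simp⟩
      cases l with
      | nil => simp; omega
      | cons y l => have := h2.1; simp; omega
    · rintro ⟨⟨h1, h2⟩, h3⟩
      exact ⟨by omega, h2, by simp⟩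
  | false, (x + 1) :: l => by
    have ih := gordon_raise hk true l
    simp only [raise, Gordon, headD_raise_true, ih]
    constructor
    · rintro ⟨h1, h2, -⟩
      exact ⟨⟨by omega, h2⟩, by simp⟩
    · rintro ⟨⟨h1, h2⟩, -⟩
      exact ⟨by omega, h2, by intro; omega⟩

/-- Every domino has one odd position, whose frequency changes by one. Blocks of odd length are
covered differently from the two ends: the last domino now sticks out above, onto an empty position.
When that position is odd its frequency becomes 1, so `c = 1`; for the block at the head this is the
case of even `p` with `topHead l`. -/
theorem parityFrom_raise_false {c : ℕ} (hc : c ≤ 1) : ∀ (l : List ℕ) (p : ℕ),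
    ParityFrom c p (raise false l) ↔
      ParityFrom (1 - c) p l ∧ (p % 2 = 0 → c = 0 → topHead l = false)
  | [], p => by simp [raise, ParityFrom, topHead]
  | 0 :: l, p => by
    simp only [raise, ParityFrom, parityFrom_raise_false hc l (p + 1), topHead, topHead_raise]
    cases topHead l <;> simp <;> grind
  | [x + 1], p => by
    simp only [raise, ParityFrom, topHead, Bool.toNat_true]
    simp
    rcases Nat.mod_two_eq_zero_or_one p with hp | hp
    · simp [hp, Nat.add_mod]
      omega
    · simp [hp, Nat.add_mod]
      omega
  | (x + 1) :: y :: l, p => by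
    simp only [raise, ParityFrom, parityFrom_raise_false hc l (p + 1 + 1), topHead, topHead_raise]
    cases topHead l <;> by_cases hy : 0 < y <;> simp [hy] <;> grind

/-- If the initial block has even length, the incoming domino shifts the pairing so that the last
domino ends on an odd empty position, whose frequency becomes 1. -/
theorem parityFrom_raise_true {c : ℕ} (hc : c ≤ 1) (l : List ℕ) :
    ParityFrom c 1 (raise true l) ↔
      ParityFrom (1 - c) 1 l ∧ (topHead l = true ∨ c = 1) := by
  cases l with
  | nil => simp [raise, ParityFrom, topHead]; omega
  | cons x l =>
    simp only [raise, ParityFrom, parityFrom_raise_false hc, topHead, topHead_raise]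
    cases topHead l <;> by_cases hx : 0 < x <;> simp [hx] <;> grind

/-! ### The recursion for frequency lists -/

/-- Frequency lists of length `M` and weight `N` with Gordon's condition, first frequency less than
`a`, parity class `c`, `d` dominoes, and a prescribed value `u` of `topHead`. -/
def gordonSet (k c a M N d : ℕ) (u : Bool) : Set (List ℕ) :=
  {f | f.length = M ∧ Gordon k f ∧ f.headD 0 < a ∧ ParityFrom c 1 f ∧ weightFrom 1 f = N ∧
    topCount f = d ∧ topHead f = u}

theorem disjoint_gordonSet (k c a M N d e : ℕ) :
    Disjoint (gordonSet k c a M N d true) (gordonSet k c a M N e false) := by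
  rw [Set.disjoint_left]
  rintro f ⟨-, -, -, -, -, -, h⟩ ⟨-, -, -, -, -, -, h'⟩
  simp [h] at h'

theorem gordonSet_one_true (k c M N d : ℕ) : gordonSet k c 1 M N d true = ∅ := by
  ext f
  simp only [gordonSet, Set.mem_ofPred_eq, Set.mem_empty_iff_false, iff_false]
  rintro ⟨-, -, h, -, -, -, h'⟩
  cases f with
  | nil => simp [topHead] at h'
  | cons x f =>
    simp [topHead] at h h'
    omega

theorem gordonSet_cap {k : ℕ} (hk : 1 ≤ k) (c M N d : ℕ) (u : Bool) :
    gordonSet k c (k + 1) M N d u = gordonSet k c k M N d u := by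
  ext f
  have : Gordon k f → f.headD 0 < k := by
    cases f with
    | nil => simp; omega
    | cons x f => rintro ⟨h, -⟩; simp; omega
  simp only [gordonSet, Set.mem_ofPred_eq]
  constructor
  · rintro ⟨h1, h2, h3, h4⟩
    exact ⟨h1, h2, this h2, h4⟩
  · rintro ⟨h1, h2, h3, h4⟩
    exact ⟨h1, h2, by omega, h4⟩

theorem raise_lower_of_mem {k c a M N d : ℕ} {u : Bool} (h : N ≤ M + 1) {f : List ℕ}
    (hf : f ∈ gordonSet k c a (M + 1) N d u) : raise u (lower f) = f := by
  obtain ⟨h1, -, -, -, h5, -, h7⟩ := hf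
  rw [← h7]
  refine raise_lower 0 f ?_ ?_
  · rintro rfl; simp at h1
  · simp only [zero_add, h5, h1, h]

theorem encard_gordonSet_false {k c a M N d : ℕ} (hk : 1 ≤ k) (hc : c ≤ 1) (ha : 1 ≤ a)
    (h : N + d ≤ M + 1) :
    (gordonSet k c a (M + 1) (N + d) d false).encard =
      (gordonSet k (1 - c) (a + 1) M N d true).encard +
        (gordonSet k (1 - c) (a + 1) M N d false).encard := by
  rw [← Set.encard_union_eq (disjoint_gordonSet ..), ← (raise_injective false).encard_image (_ ∪ _)]
  congr 1
  have key : ∀ l, raise false l ∈ gordonSet k c a (M + 1) (N + d) d false ↔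
      l ∈ gordonSet k (1 - c) (a + 1) M N d true ∪ gordonSet k (1 - c) (a + 1) M N d false := by
    intro l
    have hw := weightFrom_raise false l 0
    simp only [Bool.toNat_false, mul_zero, add_zero, zero_add, topCount_raise_false] at hw
    simp only [gordonSet, Set.mem_union, Set.mem_ofPred_eq, length_raise, gordon_raise hk,
      headD_raise_false, parityFrom_raise_false hc, hw, topCount_raise_false, topHead_raise]
    cases topHead l <;> simp <;> grind
  ext f
  constructor
  · intro hf
    have := raise_lower_of_mem h hf
    rw [← this] at hf
    exact ⟨_, (key _).1 hf, this⟩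
  · rintro ⟨l, hl, rfl⟩
    exact (key l).2 hl

/-- The second summand collects the lists for which the incoming domino raises the count. The bound
`a + 1 ≤ k` makes the extra condition of `gordon_raise` automatic. -/
theorem encard_gordonSet_true {k c a M N d : ℕ} (hc : c ≤ 1) (hak : a + 1 ≤ k)
    (h : N + (d + 1) ≤ M + 1) :
    (gordonSet k c (a + 1) (M + 1) (N + (d + 1)) (d + 1) true).encard =
      (gordonSet k (1 - c) a M N (d + 1) true).encard +
        (if c = 1 then (gordonSet k (1 - c) a M N d false).encard else 0) := by
  have hE : (if c = 1 then (gordonSet k (1 - c) a M N d false).encard else 0) =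
      Set.encard {f | f ∈ gordonSet k (1 - c) a M N d false ∧ c = 1} := by
    split_ifs with h <;> simp [h]
  rw [hE, ← Set.encard_union_eq ((disjoint_gordonSet ..).mono_right (fun _ h => h.1)),
    ← (raise_injective true).encard_image (_ ∪ _)]
  congr 1
  have key : ∀ l, raise true l ∈ gordonSet k c (a + 1) (M + 1) (N + (d + 1)) (d + 1) true ↔
      l ∈ gordonSet k (1 - c) a M N (d + 1) true ∪
        {f | f ∈ gordonSet k (1 - c) a M N d false ∧ c = 1} := by
    intro l
    have hw := weightFrom_raise true l 0
    simp only [zero_mul, add_zero, zero_add, topCount_raise_true] at hw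
    simp only [gordonSet, Set.mem_union, Set.mem_ofPred_eq, length_raise,
      gordon_raise (show 1 ≤ k by omega),
      headD_raise_true, parityFrom_raise_true hc, hw, topCount_raise_true, topHead_raise]
    cases topHead l <;> simp <;> grind
  ext f
  constructor
  · intro hf
    have := raise_lower_of_mem h hf
    rw [← this] at hf
    exact ⟨_, (key _).1 hf, this⟩
  · rintro ⟨l, hl, rfl⟩
    exact (key l).2 hl

/-! ### The same recursion for Frobenius symbols -/

/-- Frobenius symbols as lists of columns `(s, t)` with both entries strictly decreasing: weight
`N`, `d` columns, ranks `s - t` in `[2 - a, 2k - a - 1]`, hook lengths `s + t + 1` that are `c`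
modulo `2`, and `u` telling whether some upper entry vanishes. -/
def frobeniusSet (k c : ℕ) (a : ℤ) (N d : ℕ) (u : Bool) : Set (List (ℕ × ℕ)) :=
  {F | F.Pairwise (fun x y => y.1 < x.1 ∧ y.2 < x.2) ∧
    (∀ x ∈ F, 2 - a ≤ (x.1 : ℤ) - x.2 ∧ (x.1 : ℤ) - x.2 ≤ 2 * k - a - 1 ∧
      (x.1 + x.2 + 1) % 2 = c) ∧
    (F.map fun x => x.1 + x.2 + 1).sum = N ∧ F.length = d ∧ (u = true ↔ ∃ x ∈ F, x.1 = 0)}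

theorem disjoint_frobeniusSet (k c : ℕ) (a : ℤ) (N d e : ℕ) :
    Disjoint (frobeniusSet k c a N d true) (frobeniusSet k c a N e false) := by
  rw [Set.disjoint_left]
  rintro f ⟨-, -, -, -, h⟩ ⟨-, -, -, -, h'⟩
  exact absurd (h.1 rfl) (fun h => by simpa using h'.2 h)

theorem sum_hooks_map_succ_left (F : List (ℕ × ℕ)) :
    ((F.map fun x => (x.1 + 1, x.2)).map fun x => x.1 + x.2 + 1).sum =
      (F.map fun x => x.1 + x.2 + 1).sum + F.length := by
  induction F with
  | nil => simp
  | cons x F ih => simp at ih ⊢; omega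

theorem sum_hooks_map_succ_right (F : List (ℕ × ℕ)) :
    ((F.map fun x => (x.1, x.2 + 1)).map fun x => x.1 + x.2 + 1).sum =
      (F.map fun x => x.1 + x.2 + 1).sum + F.length := by
  induction F with
  | nil => simp
  | cons x F ih => simp at ih ⊢; omega

theorem succ_left_injective :
    Function.Injective (List.map fun x : ℕ × ℕ => (x.1 + 1, x.2)) :=
  List.map_injective_iff.2 fun x y h => by
    simp only [Prod.mk.injEq, Nat.add_right_cancel_iff] at h
    exact Prod.ext h.1 h.2

theorem succ_right_injective :
    Function.Injective (List.map fun x : ℕ × ℕ => (x.1, x.2 + 1)) :=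
  List.map_injective_iff.2 fun x y h => by
    simp only [Prod.mk.injEq, Nat.add_right_cancel_iff] at h
    exact Prod.ext h.1 h.2

theorem exists_map_succ_left {F : List (ℕ × ℕ)} (h : ∀ x ∈ F, x.1 ≠ 0) :
    ∃ G : List (ℕ × ℕ), G.map (fun x => (x.1 + 1, x.2)) = F := by
  refine ⟨F.map fun x => (x.1 - 1, x.2), ?_⟩
  rw [List.map_map]
  conv_rhs => rw [← List.map_id F]
  refine List.map_congr_left fun x hx => ?_
  have := h x hx
  exact Prod.ext (by simp; omega) rfl

theorem exists_map_succ_right {F : List (ℕ × ℕ)} (h : ∀ x ∈ F, x.2 ≠ 0) :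
    ∃ G : List (ℕ × ℕ), G.map (fun x => (x.1, x.2 + 1)) = F := by
  refine ⟨F.map fun x => (x.1, x.2 - 1), ?_⟩
  rw [List.map_map]
  conv_rhs => rw [← List.map_id F]
  refine List.map_congr_left fun x hx => ?_
  have := h x hx
  exact Prod.ext rfl (by simp; omega)

theorem map_succ_left_mem {k c : ℕ} {a : ℤ} {N d : ℕ} (hc : c ≤ 1) (G : List (ℕ × ℕ)) :
    G.map (fun x => (x.1 + 1, x.2)) ∈ frobeniusSet k c a (N + d) d false ↔
      G ∈ frobeniusSet k (1 - c) (a + 1) N d true ∪ frobeniusSet k (1 - c) (a + 1) N d false := by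
  have hu : G ∈ frobeniusSet k (1 - c) (a + 1) N d true ∪
      frobeniusSet k (1 - c) (a + 1) N d false ↔
      G.Pairwise (fun x y => y.1 < x.1 ∧ y.2 < x.2) ∧
      (∀ x ∈ G, 2 - (a + 1) ≤ (x.1 : ℤ) - x.2 ∧ (x.1 : ℤ) - x.2 ≤ 2 * k - (a + 1) - 1 ∧
        (x.1 + x.2 + 1) % 2 = 1 - c) ∧
      (G.map fun x => x.1 + x.2 + 1).sum = N ∧ G.length = d := by
    simp only [frobeniusSet, Set.mem_union, Set.mem_ofPred_eq]
    by_cases h : ∃ x ∈ G, x.1 = 0 <;> simp only [h] <;> simp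
  rw [hu, frobeniusSet, Set.mem_ofPred_eq, sum_hooks_map_succ_left, List.pairwise_map]
  simp only [List.length_map, List.forall_mem_map, Nat.add_lt_add_iff_right]
  refine and_congr_right fun _ => and_congr ?_ ?_
  · refine forall₂_congr fun x _ => ?_
    push_cast
    omega
  · constructor
    · rintro ⟨h1, h2, -⟩
      exact ⟨by omega, h2⟩
    · rintro ⟨h1, h2⟩
      refine ⟨by omega, h2, ?_⟩
      simp

theorem encard_frobeniusSet_false {k c : ℕ} {a : ℤ} {N d : ℕ} (hc : c ≤ 1) :
    (frobeniusSet k c a (N + d) d false).encard =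
      (frobeniusSet k (1 - c) (a + 1) N d true).encard +
        (frobeniusSet k (1 - c) (a + 1) N d false).encard := by
  rw [← Set.encard_union_eq (disjoint_frobeniusSet ..), ← succ_left_injective.encard_image (_ ∪ _)]
  congr 1
  ext F
  constructor
  · intro hF
    obtain ⟨G, rfl⟩ := exists_map_succ_left (F := F) fun x hx h0 => by
      simpa using hF.2.2.2.2.2 ⟨x, hx, h0⟩
    exact ⟨G, (map_succ_left_mem hc G).1 hF, rfl⟩
  · rintro ⟨G, hG, rfl⟩
    exact (map_succ_left_mem hc G).2 hG

theorem map_succ_right_mem {k c : ℕ} {a : ℤ} {N d : ℕ} (hc : c ≤ 1) (G : List (ℕ × ℕ)) :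
    G.map (fun x => (x.1, x.2 + 1)) ∈ frobeniusSet k c (a + 1) (N + d) d true ↔
      G ∈ frobeniusSet k (1 - c) a N d true := by
  simp only [frobeniusSet, Set.mem_ofPred_eq, sum_hooks_map_succ_right, List.pairwise_map]
  simp only [List.length_map, List.forall_mem_map, Nat.add_lt_add_iff_right]
  refine and_congr_right fun _ => and_congr ?_ ?_
  · refine forall₂_congr fun x _ => ?_
    push_cast
    omega
  · constructor
    · rintro ⟨h1, h2, h3⟩
      exact ⟨by omega, h2, by simpa using h3⟩
    · rintro ⟨h1, h2, h3⟩
      exact ⟨by omega, h2, by simpa using h3⟩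

/-- The column `(0, 0)` has hook length 1, hence `c = 1`, and rank 0, which the bounds on `a` put
inside the allowed interval. Strict decrease leaves no other vanishing upper entry. -/
theorem map_succ_right_append_mem {k c : ℕ} {a : ℤ} {N d : ℕ}
    (ha : 1 ≤ a) (hak : a + 1 ≤ k) (G : List (ℕ × ℕ)) :
    G.map (fun x => (x.1, x.2 + 1)) ++ [(0, 0)] ∈
        frobeniusSet k c (a + 1) (N + (d + 1)) (d + 1) true ↔
      G ∈ frobeniusSet k (1 - c) a N d false ∧ c = 1 := by
  simp only [frobeniusSet, Set.mem_ofPred_eq, List.map_append, List.sum_append,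
    sum_hooks_map_succ_right, List.pairwise_append, List.pairwise_map]
  simp only [List.length_append, List.length_map, Nat.add_lt_add_iff_right,
    List.forall_mem_append, List.forall_mem_map, List.forall_mem_singleton,
    List.pairwise_singleton, List.length_singleton, List.map_cons, List.map_nil,
    List.sum_singleton]
  constructor
  · rintro ⟨⟨h1, -, h2⟩, ⟨h3, h4⟩, h5, h6, h7⟩
    have hc1 : c = 1 := by simp at h4; omega
    refine ⟨⟨h1, ?_, by omega, by omega, ?_⟩, hc1⟩
    · intro x hx
      have := h3 x hx
      push_cast at this
      omega
    · simp only [Bool.false_eq_true, false_iff, not_exists, not_and]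
      intro x hx h0
      have := (h2 x hx).1
      omega
  · rintro ⟨⟨h1, h2, h3, h4, h5⟩, hc1⟩
    refine ⟨⟨h1, trivial, ?_⟩, ⟨?_, ?_⟩, by omega, by omega, ?_⟩
    · intro x hx
      refine ⟨?_, by simp⟩
      by_contra h0
      simpa using h5.2 ⟨x, hx, by simpa using h0⟩
    · intro x hx
      have := h2 x hx
      push_cast
      omega
    · push_cast
      omega
    · simp

theorem encard_frobeniusSet_true {k c : ℕ} {a : ℤ} {N d : ℕ} (hc : c ≤ 1)
    (ha : 1 ≤ a) (hak : a + 1 ≤ k) :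
    (frobeniusSet k c (a + 1) (N + (d + 1)) (d + 1) true).encard =
      (frobeniusSet k (1 - c) a N (d + 1) true).encard +
        (if c = 1 then (frobeniusSet k (1 - c) a N d false).encard else 0) := by
  have hE : (if c = 1 then (frobeniusSet k (1 - c) a N d false).encard else 0) =
      Set.encard {f | f ∈ frobeniusSet k (1 - c) a N d false ∧ c = 1} := by
    split_ifs with h <;> simp [h]
  have hinj : Function.Injective
      (fun G : List (ℕ × ℕ) => G.map (fun x => (x.1, x.2 + 1)) ++ [(0, 0)]) :=
    fun G H h => succ_right_injective (List.append_left_injective _ h)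
  rw [hE, ← succ_right_injective.encard_image (frobeniusSet k (1 - c) a N (d + 1) true),
    ← hinj.encard_image {f | f ∈ frobeniusSet k (1 - c) a N d false ∧ c = 1}, ← Set.encard_union_eq]
  · congr 1
    ext F
    constructor
    · intro hF
      by_cases h0 : ∀ x ∈ F, x.2 ≠ 0
      · obtain ⟨G, rfl⟩ := exists_map_succ_right h0
        exact Or.inl ⟨G, (map_succ_right_mem hc G).1 hF, rfl⟩
      · right
        push Not at h0
        obtain ⟨y, hy, hy0⟩ := h0
        obtain ⟨x, hx, hx0⟩ := hF.2.2.2.2.1 rfl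
        -- By strict decrease both a vanishing upper and a vanishing lower entry must sit in the
        -- last column, which is therefore `(0, 0)`.
        rcases List.eq_nil_or_concat' F with rfl | ⟨F, z, rfl⟩
        · simp at hx
        have hp := List.pairwise_append.1 hF.1
        have hz : ∀ w ∈ F, z.1 < w.1 ∧ z.2 < w.2 := fun w hw => hp.2.2 w hw z (by simp)
        have hz1 : z.1 = 0 := by
          rcases List.mem_append.1 hx with h | h
          · have := hz x h; omega
          · rw [← List.mem_singleton.1 h, hx0]
        have hz2 : z.2 = 0 := by
          rcases List.mem_append.1 hy with h | h
          · have := hz y h; omega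
          · rw [← List.mem_singleton.1 h, hy0]
        obtain rfl : z = (0, 0) := Prod.ext hz1 hz2
        obtain ⟨G, rfl⟩ := exists_map_succ_right (F := F) fun w hw h => by
          have := hz w hw
          omega
        exact ⟨G, (map_succ_right_append_mem ha hak G).1 hF, rfl⟩
    · rintro (⟨G, hG, rfl⟩ | ⟨G, hG, rfl⟩)
      · exact (map_succ_right_mem hc G).2 hG
      · exact (map_succ_right_append_mem ha hak G).2 hG
  · rw [Set.disjoint_left]
    rintro F ⟨G, -, rfl⟩ ⟨H, -, h⟩
    have : ((0, 0) : ℕ × ℕ) ∈ G.map (fun x => (x.1, x.2 + 1)) := by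
      rw [← h]; simp
    simp at this

theorem frobeniusSet_one_true (k c N d : ℕ) : frobeniusSet k c 1 N d true = ∅ := by
  ext F
  simp only [Set.mem_empty_iff_false, iff_false]
  rintro ⟨-, h, -, -, hu⟩
  obtain ⟨x, hx, h0⟩ := hu.1 rfl
  have := (h x hx).1
  omega

/-- Conjugation negates ranks and keeps hook lengths. An inequality suffices, since `a ↦ 2k + 1 - a`
is an involution. The two flags are united because conjugation does not respect them. -/
theorem encard_frobeniusSet_conj_le (k c : ℕ) (a : ℤ) (N d : ℕ) :
    (frobeniusSet k c a N d true ∪ frobeniusSet k c a N d false).encard ≤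
      (frobeniusSet k c (2 * k + 1 - a) N d true ∪
        frobeniusSet k c (2 * k + 1 - a) N d false).encard := by
  rw [← (List.map_injective_iff.2 (Prod.swap_injective (α := ℕ) (β := ℕ))).encard_image]
  refine Set.encard_le_encard ?_
  rintro _ ⟨F, hF, rfl⟩
  have hF : F.Pairwise (fun x y => y.1 < x.1 ∧ y.2 < x.2) ∧
      (∀ x ∈ F, 2 - a ≤ (x.1 : ℤ) - x.2 ∧ (x.1 : ℤ) - x.2 ≤ 2 * k - a - 1 ∧
        (x.1 + x.2 + 1) % 2 = c) ∧
      (F.map fun x => x.1 + x.2 + 1).sum = N ∧ F.length = d := by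
    rcases hF with ⟨h1, h2, h3, h4, -⟩ | ⟨h1, h2, h3, h4, -⟩ <;> exact ⟨h1, h2, h3, h4⟩
  have key : (F.map Prod.swap).Pairwise (fun x y => y.1 < x.1 ∧ y.2 < x.2) ∧
      (∀ x ∈ F.map Prod.swap, 2 - (2 * k + 1 - a) ≤ (x.1 : ℤ) - x.2 ∧
        (x.1 : ℤ) - x.2 ≤ 2 * k - (2 * k + 1 - a) - 1 ∧ (x.1 + x.2 + 1) % 2 = c) ∧
      ((F.map Prod.swap).map fun x => x.1 + x.2 + 1).sum = N ∧ (F.map Prod.swap).length = d := by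
    refine ⟨?_, ?_, ?_, ?_⟩
    · rw [List.pairwise_map]
      exact hF.1.imp fun h => ⟨h.2, h.1⟩
    · rw [List.forall_mem_map]
      intro x hx
      have := hF.2.1 x hx
      simp only [Prod.fst_swap, Prod.snd_swap]
      omega
    · rw [← hF.2.2.1, List.map_map]
      congr 1
      refine List.map_congr_left fun x _ => ?_
      simp [add_comm]
    · rw [List.length_map, hF.2.2.2]
  by_cases h : ∃ x ∈ F.map Prod.swap, x.1 = 0
  · exact Or.inl ⟨key.1, key.2.1, key.2.2.1, key.2.2.2, by simpa using h⟩
  · exact Or.inr ⟨key.1, key.2.1, key.2.2.1, key.2.2.2, by simpa using h⟩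

theorem encard_frobeniusSet_cap (k c N d : ℕ) :
    (frobeniusSet k c ((k : ℤ) + 1) N d true).encard +
        (frobeniusSet k c ((k : ℤ) + 1) N d false).encard =
      (frobeniusSet k c k N d true).encard + (frobeniusSet k c k N d false).encard := by
  rw [← Set.encard_union_eq (disjoint_frobeniusSet ..),
    ← Set.encard_union_eq (disjoint_frobeniusSet ..)]
  apply le_antisymm
  · have h := encard_frobeniusSet_conj_le k c ((k : ℤ) + 1) N d
    rwa [show 2 * (k : ℤ) + 1 - (k + 1) = k by ring] at h
  · have h := encard_frobeniusSet_conj_le k c k N d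
    rwa [show 2 * (k : ℤ) + 1 - k = k + 1 by ring] at h

/-! ### Equality of the refined counts -/

theorem topCount_le_weightFrom : ∀ (f : List ℕ) (p : ℕ), topCount f ≤ weightFrom (p + 1) f
  | [], _ => by simp [topCount]
  | x :: f, p => by
    have ih := topCount_le_weightFrom f (p + 1)
    have hx : (topHead (x :: f)).toNat ≤ (p + 1) * x := by
      rcases Nat.eq_zero_or_pos x with rfl | hx
      · simp [topHead]
      · exact (Bool.toNat_le _).trans (Nat.mul_pos p.succ_pos hx)
    simp only [topCount, weightFrom]
    omega

theorem length_le_sum_hooks (F : List (ℕ × ℕ)) :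
    F.length ≤ (F.map fun x => x.1 + x.2 + 1).sum := by
  induction F with
  | nil => simp
  | cons x F ih => simp at ih ⊢; omega

theorem eq_replicate_of_topCount_eq_zero : ∀ f : List ℕ, topCount f = 0 →
    f = List.replicate f.length 0
  | [], _ => rfl
  | x :: f, h => by
    simp only [topCount, Nat.add_eq_zero_iff] at h
    have ih := eq_replicate_of_topCount_eq_zero f h.2
    have hf : topHead f = false := by
      cases f with
      | nil => rfl
      | cons y f =>
        have := h.2
        simp only [topCount, Nat.add_eq_zero_iff] at this
        simpa using this.1
    have hx : x = 0 := by simpa [topHead, hf] using h.1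
    rw [List.length_cons, List.replicate_succ, ← ih, hx]

theorem replicate_zero_spec (k c : ℕ) (hk : 1 ≤ k) : ∀ M p : ℕ,
    Gordon k (List.replicate M 0) ∧ (List.replicate M 0).headD 0 = 0 ∧
    ParityFrom c p (List.replicate M 0) ∧ weightFrom p (List.replicate M 0) = 0 ∧
    topCount (List.replicate M 0) = 0 ∧ topHead (List.replicate M 0) = false
  | 0, p => by simp [Gordon, ParityFrom, weightFrom, topCount, topHead]
  | M + 1, p => by
    obtain ⟨h1, h2, h3, h4, h5, h6⟩ := replicate_zero_spec k c hk M (p + 1)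
    simp only [List.replicate_succ, Gordon, ParityFrom, weightFrom, topCount, topHead,
      h1, h2, h3, h4, h5, h6]
    simp [hk]

theorem gordonSet_zero {k a : ℕ} (hk : 1 ≤ k) (ha : 1 ≤ a) (c M N : ℕ) (u : Bool) :
    gordonSet k c a M N 0 u = {f | f = List.replicate M 0 ∧ N = 0 ∧ u = false} := by
  obtain ⟨h1, h2, h3, h4, h5, h6⟩ := replicate_zero_spec k c hk M 1
  ext f
  simp only [gordonSet, Set.mem_ofPred_eq]
  constructor
  · rintro ⟨g1, g2, g3, g4, g5, g6, g7⟩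
    have := eq_replicate_of_topCount_eq_zero f g6
    rw [g1] at this
    subst this
    exact ⟨rfl, by omega, by rw [← g7, h6]⟩
  · rintro ⟨rfl, rfl, rfl⟩
    exact ⟨by simp, h1, by omega, h3, h4, h5, h6⟩

theorem frobeniusSet_zero (k c : ℕ) (a : ℤ) (N : ℕ) (u : Bool) :
    frobeniusSet k c a N 0 u = {F | F = [] ∧ N = 0 ∧ u = false} := by
  ext F
  simp only [frobeniusSet, Set.mem_ofPred_eq]
  constructor
  · rintro ⟨-, -, g3, g4, g5⟩
    obtain rfl := List.length_eq_zero_iff.1 g4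
    exact ⟨rfl, by simpa using g3.symm, by simpa using g5⟩
  · rintro ⟨rfl, rfl, rfl⟩
    simp

theorem encard_setOf_eq_and {α : Type*} (x : α) (P : Prop) [Decidable P] :
    {y | y = x ∧ P}.encard = if P then 1 else 0 := by
  split_ifs with h <;> simp [h]

/-- Strong induction on the weight: with at least one domino or column, each recursion strictly
lowers it. The length `M` only has to be at least `N`. -/
theorem encard_gordonSet_eq_frobeniusSet {k : ℕ} (hk : 1 ≤ k) (N : ℕ) :
    ∀ (M d c a : ℕ) (u : Bool), N ≤ M → c ≤ 1 → 1 ≤ a → a ≤ k →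
      (gordonSet k c a M N d u).encard = (frobeniusSet k c a N d u).encard := by
  induction N using Nat.strong_induction_on with
  | _ N ih =>
  intro M d c a u hM hc ha hak
  rcases d with _ | d
  · rw [gordonSet_zero hk ha, frobeniusSet_zero, encard_setOf_eq_and, encard_setOf_eq_and]
  rcases lt_or_ge N (d + 1) with hN | hN
  · rw [Set.encard_eq_zero.2, Set.encard_eq_zero.2]
    · refine Set.eq_empty_of_forall_notMem fun F hF => ?_
      have := length_le_sum_hooks F
      rw [hF.2.2.1, hF.2.2.2.1] at this
      omega
    · refine Set.eq_empty_of_forall_notMem fun f hf => ?_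
      have := topCount_le_weightFrom f 0
      rw [hf.2.2.2.2.1, hf.2.2.2.2.2.1] at this
      omega
  obtain ⟨N, rfl⟩ := Nat.exists_eq_add_of_le' hN
  obtain ⟨M, rfl⟩ := Nat.exists_eq_add_of_le' (show 1 ≤ M by omega)
  have hc' : 1 - c ≤ 1 := Nat.sub_le ..
  cases u
  · rw [encard_gordonSet_false hk hc ha hM, encard_frobeniusSet_false hc]
    rcases hak.lt_or_eq with hlt | rfl
    · rw [ih N (by omega) M _ _ _ _ (by omega) hc' (by omega) hlt,
        ih N (by omega) M _ _ _ _ (by omega) hc' (by omega) hlt]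
      push_cast
      rfl
    -- Here `a = k`, and `a + 1` falls outside the induction range; both caps bring it back to `k`,
    -- on the Frobenius side only for the sum over the flags.
    · rw [gordonSet_cap hk, gordonSet_cap hk, encard_frobeniusSet_cap,
        ih N (by omega) M _ _ _ _ (by omega) hc' ha le_rfl,
        ih N (by omega) M _ _ _ _ (by omega) hc' ha le_rfl]
  · obtain ⟨a, rfl⟩ := Nat.exists_eq_add_of_le' ha
    rcases Nat.eq_zero_or_pos a with rfl | ha'
    · rw [zero_add, gordonSet_one_true, Nat.cast_one, frobeniusSet_one_true]
      simp
    · rw [encard_gordonSet_true hc hak hM, Nat.cast_add, Nat.cast_one,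
        encard_frobeniusSet_true hc (by exact_mod_cast ha') (by exact_mod_cast hak),
        ih N (by omega) M _ _ _ _ (by omega) hc' ha' (by omega),
        ih N (by omega) M _ _ _ _ (by omega) hc' ha' (by omega)]

/-! ### Partitions and their Frobenius symbols -/

/-- The list of parts of the partition with the given Frobenius symbol. -/
def partsOfFrobenius : List (ℕ × ℕ) → List ℕ
  | [] => []
  | x :: F => (x.1 + 1) :: ((partsOfFrobenius F).map (· + 1) ++
      List.replicate (x.2 - (partsOfFrobenius F).length) 1)

/-- Remove one from every part, and discard the parts that become zero. -/
def removeColumn (l : List ℕ) : List ℕ := (l.map (· - 1)).filter (0 < ·)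

/-- The columns of a Frobenius symbol decrease strictly in both entries. -/
abbrev IsFrobenius (F : List (ℕ × ℕ)) : Prop :=
  F.Pairwise fun x y => y.1 < x.1 ∧ y.2 < x.2

theorem length_partsOfFrobenius_cons : ∀ {x : ℕ × ℕ} {F : List (ℕ × ℕ)}, IsFrobenius (x :: F) →
    (partsOfFrobenius (x :: F)).length = x.2 + 1
  | x, [], _ => by simp [partsOfFrobenius]
  | x, y :: F, h => by
    have ih := length_partsOfFrobenius_cons (List.pairwise_cons.1 h).2
    have := ((List.pairwise_cons.1 h).1 y (by simp)).2
    rw [partsOfFrobenius, List.length_cons, List.length_append, List.length_map,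
      List.length_replicate, ih]
    omega

theorem length_partsOfFrobenius_le {x : ℕ × ℕ} {F : List (ℕ × ℕ)} (h : IsFrobenius (x :: F)) :
    (partsOfFrobenius F).length ≤ x.2 := by
  have := length_partsOfFrobenius_cons h
  rw [partsOfFrobenius] at this
  simp at this
  omega

theorem partsOfFrobenius_bounds : ∀ {F : List (ℕ × ℕ)}, IsFrobenius F →
    (partsOfFrobenius F).Pairwise (· ≥ ·) ∧ (∀ y ∈ partsOfFrobenius F, 0 < y) ∧
      ∀ x : ℕ × ℕ, IsFrobenius (x :: F) → ∀ y ∈ partsOfFrobenius F, y ≤ x.1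
  | [], _ => by simp [partsOfFrobenius]
  | z :: F, h => by
    obtain ⟨h1, h2, h3⟩ := partsOfFrobenius_bounds (List.pairwise_cons.1 h).2
    have h3 := h3 z h
    refine ⟨?_, ?_, ?_⟩
    · rw [partsOfFrobenius, List.pairwise_cons, List.pairwise_append, List.pairwise_map]
      refine ⟨?_, h1.imp (by intros; omega), by simp [List.pairwise_replicate], ?_⟩
      · intro y hy
        rcases List.mem_append.1 hy with hy | hy
        · obtain ⟨w, hw, rfl⟩ := List.mem_map.1 hy
          have := h3 w hw
          omega
        · have := List.eq_of_mem_replicate hy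
          omega
      · intro y hy w hw
        obtain ⟨v, -, rfl⟩ := List.mem_map.1 hy
        have := List.eq_of_mem_replicate hw
        omega
    · intro y hy
      rw [partsOfFrobenius, List.mem_cons, List.mem_append, List.mem_map] at hy
      rcases hy with rfl | ⟨v, -, rfl⟩ | hy
      · omega
      · omega
      · have := List.eq_of_mem_replicate hy
        omega
    · intro x hx y hy
      have hzx := ((List.pairwise_cons.1 hx).1 z (by simp)).1
      rw [partsOfFrobenius, List.mem_cons, List.mem_append, List.mem_map] at hy
      rcases hy with rfl | ⟨v, hv, rfl⟩ | hy
      · omega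
      · have := h3 v hv
        omega
      · have := List.eq_of_mem_replicate hy
        omega

theorem sum_partsOfFrobenius : ∀ {F : List (ℕ × ℕ)}, IsFrobenius F →
    (partsOfFrobenius F).sum = (F.map fun x => x.1 + x.2 + 1).sum
  | [], _ => by simp [partsOfFrobenius]
  | z :: F, h => by
    have ih := sum_partsOfFrobenius (List.pairwise_cons.1 h).2
    have hl := length_partsOfFrobenius_le h
    have hs : ∀ l : List ℕ, (l.map (· + 1)).sum = l.sum + l.length := by
      intro l
      induction l with
      | nil => simp
      | cons a l ih => simp [ih]; omega
    rw [partsOfFrobenius, List.sum_cons, List.sum_append, hs, ih, List.sum_replicate,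
      List.map_cons, List.sum_cons, smul_eq_mul]
    omega

theorem removeColumn_append_replicate {l : List ℕ} (h : ∀ y ∈ l, 0 < y) (r : ℕ) :
    removeColumn (l.map (· + 1) ++ List.replicate r 1) = l := by
  rw [removeColumn, List.map_append, List.filter_append, List.map_map, List.map_replicate]
  have h1 : List.map ((· - 1) ∘ (· + 1)) l = l := by
    conv_rhs => rw [← List.map_id l]
    exact List.map_congr_left fun _ _ => rfl
  rw [h1, List.filter_eq_self.2 (by simpa using h), List.filter_eq_nil_iff.2, List.append_nil]
  intro a ha
  have := List.eq_of_mem_replicate ha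
  simp [this]

/-- The outer hook is recovered from the largest part and the number of parts; removing the first
row and column leaves the partition of the remaining columns. -/
theorem partsOfFrobenius_injOn : Set.InjOn partsOfFrobenius {F | IsFrobenius F} := by
  intro F
  induction F with
  | nil =>
    rintro - (_ | ⟨x, G⟩) - h
    · rfl
    · simp [partsOfFrobenius] at h
  | cons x F ih =>
    rintro hF (_ | ⟨y, G⟩) hG h
    · simp [partsOfFrobenius] at h
    · have hF' := (List.pairwise_cons.1 hF).2
      have hG' := (List.pairwise_cons.1 hG).2
      have h2 : x.2 = y.2 := by
        have := congrArg List.length h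
        rw [length_partsOfFrobenius_cons hF, length_partsOfFrobenius_cons hG] at this
        omega
      rw [partsOfFrobenius, partsOfFrobenius, List.cons.injEq] at h
      have h1 : x.1 = y.1 := by omega
      have h3 := congrArg removeColumn h.2
      rw [removeColumn_append_replicate (partsOfFrobenius_bounds hF').2.1,
        removeColumn_append_replicate (partsOfFrobenius_bounds hG').2.1] at h3
      rw [ih hF' hG' h3, Prod.ext h1 h2]

theorem map_succ_removeColumn_append : ∀ {l : List ℕ}, l.Pairwise (· ≥ ·) → (∀ y ∈ l, 0 < y) →
    (removeColumn l).map (· + 1) ++ List.replicate (l.length - (removeColumn l).length) 1 = l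
  | [], _, _ => by simp [removeColumn]
  | y :: l, hs, hp => by
    rw [List.pairwise_cons] at hs
    have hy := hp y (by simp)
    have ih := map_succ_removeColumn_append hs.2 fun z hz => hp z (by simp [hz])
    by_cases hy1 : y = 1
    · have hr : removeColumn (y :: l) = [] := by
        rw [removeColumn, List.filter_eq_nil_iff]
        intro a ha
        obtain ⟨b, hb, rfl⟩ := List.mem_map.1 ha
        have : b ≤ y := by
          rcases List.mem_cons.1 hb with rfl | hb
          · rfl
          · exact hs.1 b hb
        simp
        omega
      rw [hr, List.map_nil, List.nil_append, eq_comm, List.eq_replicate_iff]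
      refine ⟨by simp, fun b hb => ?_⟩
      have h0 := hp b hb
      rcases List.mem_cons.1 hb with rfl | hb
      · exact hy1
      · have := hs.1 b hb
        omega
    · have hr : removeColumn (y :: l) = (y - 1) :: removeColumn l := by
        rw [removeColumn, List.map_cons, List.filter_cons_of_pos (by simp; omega), removeColumn]
      rw [hr, List.map_cons, List.cons_append, List.length_cons, List.length_cons,
        Nat.add_sub_add_right, ih]
      congr 1
      omega

theorem exists_partsOfFrobenius_eq (n : ℕ) : ∀ l : List ℕ, l.length ≤ n → l.Pairwise (· ≥ ·) →
    (∀ y ∈ l, 0 < y) → ∃ F, IsFrobenius F ∧ partsOfFrobenius F = l := by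
  induction n with
  | zero =>
    intro l hl _ _
    obtain rfl : l = [] := List.length_eq_zero_iff.1 (by omega)
    exact ⟨[], List.Pairwise.nil, rfl⟩
  | succ n ih =>
    rintro (_ | ⟨x, l⟩) hl hs hp
    · exact ⟨[], List.Pairwise.nil, rfl⟩
    rw [List.pairwise_cons] at hs
    have hp' : ∀ y ∈ l, 0 < y := fun y hy => hp y (by simp [hy])
    have hx := hp x (by simp)
    have hlen : (removeColumn l).length ≤ l.length := by
      rw [removeColumn]
      exact (List.length_filter_le _ _).trans (by simp)
    have hmem : ∀ y ∈ removeColumn l, 0 < y ∧ y + 1 ≤ x := by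
      intro y hy
      rw [removeColumn, List.mem_filter, List.mem_map] at hy
      obtain ⟨⟨z, hz, rfl⟩, hy⟩ := hy
      have := hs.1 z hz
      have := hp' z hz
      simp at hy
      omega
    obtain ⟨F, hF, hFl⟩ := ih (removeColumn l) (by simp at hl; omega) (by
      rw [removeColumn]
      refine List.Pairwise.filter _ (List.pairwise_map.2 (hs.2.imp ?_))
      intro a b hab
      omega) (fun y hy => (hmem y hy).1)
    refine ⟨(x - 1, l.length) :: F, List.pairwise_cons.2 ⟨?_, hF⟩, ?_⟩
    · have hhead : ∀ z G, F = z :: G → z.1 < x - 1 ∧ z.2 < l.length := by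
        rintro z G rfl
        have h1 := (hmem (z.1 + 1) (by rw [← hFl, partsOfFrobenius]; simp)).2
        have h2 := length_partsOfFrobenius_cons hF
        rw [hFl] at h2
        omega
      intro w hw
      rcases F with _ | ⟨z, G⟩
      · simp at hw
      · have hz := hhead z G rfl
        rcases List.mem_cons.1 hw with rfl | hw
        · exact hz
        · have := (List.pairwise_cons.1 hF).1 w hw
          exact ⟨this.1.trans hz.1, this.2.trans hz.2⟩
    · rw [partsOfFrobenius, hFl, map_succ_removeColumn_append hs.2 hp']
      congr 1
      simp only
      omega

theorem le_getD_partsOfFrobenius_iff : ∀ (F : List (ℕ × ℕ)) (m : ℕ),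
    m + 1 ≤ (partsOfFrobenius F).getD m 0 ↔ m + 1 ≤ F.length
  | [], m => by simp [partsOfFrobenius]
  | x :: F, 0 => by simp [partsOfFrobenius]
  | x :: F, m + 1 => by
    have ih := le_getD_partsOfFrobenius_iff F m
    rw [partsOfFrobenius, List.getD_cons_succ, List.length_cons, Nat.add_le_add_iff_right (n := 1),
      ← ih]
    by_cases hm : m < (partsOfFrobenius F).length
    · rw [List.getD_append _ _ _ _ (by simpa using hm), List.getD_eq_getElem _ _ (by simpa using hm),
        List.getElem_map, List.getD_eq_getElem _ _ hm]
      omega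
    -- Beyond the inner partition only parts 1 and the default 0 occur, so both inequalities fail.
    · have h0 : (partsOfFrobenius F).getD m 0 = 0 := List.getD_eq_default _ _ (by omega)
      rw [List.getD_append_right _ _ _ _ (by simpa using hm), h0]
      have : ∀ r q : ℕ, (List.replicate r 1).getD q 0 ≤ 1 := by
        intro r q
        rw [List.getD_eq_getElem?_getD, List.getElem?_replicate]
        split_ifs <;> simp
      have := this (x.2 - (partsOfFrobenius F).length)
        (m - ((partsOfFrobenius F).map (· + 1)).length)
      omega

theorem getD_partsOfFrobenius : ∀ {F : List (ℕ × ℕ)}, IsFrobenius F → ∀ (m : ℕ)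
    (hm : m < F.length), (partsOfFrobenius F).getD m 0 = F[m].1 + (m + 1) ∧
      (partsOfFrobenius F).countP (m + 1 ≤ ·) = F[m].2 + (m + 1)
  | [], _, m, hm => by simp at hm
  | x :: F, hF, 0, _ => by
    refine ⟨by simp [partsOfFrobenius], ?_⟩
    rw [List.countP_eq_length.2, length_partsOfFrobenius_cons hF]
    · simp
    · intro y hy
      simpa [Nat.one_le_iff_ne_zero, Nat.pos_iff_ne_zero] using
        (partsOfFrobenius_bounds hF).2.1 y hy
  | x :: F, hF, m + 1, hm => by
    have hF' := (List.pairwise_cons.1 hF).2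
    have hm' : m < F.length := by simpa using hm
    obtain ⟨h1, h2⟩ := getD_partsOfFrobenius hF' m hm'
    have hl : m < (partsOfFrobenius F).length := by
      by_contra hc
      rw [List.getD_eq_default _ _ (by omega)] at h1
      omega
    rw [partsOfFrobenius]
    constructor
    · rw [List.getD_cons_succ, List.getD_append _ _ _ _ (by simpa using hl),
        List.getD_eq_getElem _ _ (by simpa using hl), List.getElem_map,
        ← List.getD_eq_getElem _ 0 hl, h1, List.getElem_cons_succ]
      omega
    · have hx : m + 1 ≤ x.1 := by
        have := (partsOfFrobenius_bounds hF').2.2 x hF _ (List.getElem_mem hl)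
        rw [← List.getD_eq_getElem _ 0 hl, h1] at this
        omega
      have h3 : List.countP (m + 1 + 1 ≤ ·) (List.replicate
          (x.2 - (partsOfFrobenius F).length) 1) = 0 := by
        rw [List.countP_eq_zero]
        intro y hy
        have := List.eq_of_mem_replicate hy
        simp [this]
      have h4 : List.countP ((fun y => decide (m + 1 + 1 ≤ y)) ∘ (· + 1)) (partsOfFrobenius F) =
          List.countP (m + 1 ≤ ·) (partsOfFrobenius F) :=
        List.countP_congr fun y _ => by simp
      rw [List.countP_cons_of_pos (by simpa using hx), List.countP_append, List.countP_map, h3, h4,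
        h2, List.getElem_cons_succ]
      omega

section

variable {N : ℕ} {p : N.Partition} {F : List (ℕ × ℕ)}

theorem durfeeSize_eq_length (hF : IsFrobenius F)
    (hp : p.parts.sort (· ≥ ·) = partsOfFrobenius F) : durfeeSize p = F.length := by
  have hN : (F.map fun x => x.1 + x.2 + 1).sum = N := by
    rw [← sum_partsOfFrobenius hF, ← hp, ← Multiset.sum_coe, Multiset.sort_eq, p.parts_sum]
  have key : ∀ m, m + 1 ≤ partAt p (m + 1) ↔ m + 1 ≤ F.length := fun m => by
    rw [partAt, hp, Nat.add_sub_cancel, le_getD_partsOfFrobenius_iff]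
  rw [durfeeSize, Nat.findGreatest_eq_iff]
  refine ⟨hN ▸ length_le_sum_hooks F, fun h0 => ?_, fun m hm _ => ?_⟩
  · obtain ⟨m, hm⟩ := Nat.exists_eq_succ_of_ne_zero h0
    rw [hm]
    exact (key m).2 hm.ge
  · obtain ⟨m, rfl⟩ := Nat.exists_eq_succ_of_ne_zero (show m ≠ 0 by omega)
    rw [Nat.succ_eq_add_one, key]
    omega

theorem successiveRank_eq (hF : IsFrobenius F)
    (hp : p.parts.sort (· ≥ ·) = partsOfFrobenius F) (m : ℕ) (hm : m < F.length) :
    successiveRank p (m + 1) = (F[m].1 : ℤ) - F[m].2 := by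
  obtain ⟨h1, h2⟩ := getD_partsOfFrobenius hF m hm
  have hc : conjPartAt p (m + 1) = F[m].2 + (m + 1) := by
    rw [conjPartAt, ← h2, ← hp, List.countP_eq_length_filter, ← Multiset.coe_card,
      ← Multiset.filter_coe, Multiset.sort_eq]
  rw [successiveRank, frobeniusTop, frobeniusBot, hc, partAt, hp, Nat.add_sub_cancel, h1]
  push_cast
  ring

end

theorem encard_setOf_successiveRank (N : ℕ) (P : ℤ → Prop) :
    {p : N.Partition | ∀ j : ℕ, 1 ≤ j → j ≤ durfeeSize p → P (successiveRank p j)}.encard =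
      {F : List (ℕ × ℕ) | IsFrobenius F ∧ (∀ x ∈ F, P ((x.1 : ℤ) - x.2)) ∧
        (F.map fun x => x.1 + x.2 + 1).sum = N}.encard := by
  have hinj : Function.Injective fun p : N.Partition => p.parts.sort (· ≥ ·) := by
    intro p q h
    refine Nat.Partition.ext ?_
    rw [← Multiset.sort_eq p.parts (· ≥ ·), ← Multiset.sort_eq q.parts (· ≥ ·)]
    exact congrArg _ h
  rw [← hinj.encard_image,
    ← (partsOfFrobenius_injOn.mono fun F (hF : _ ∧ _) => hF.1 : Set.InjOn partsOfFrobenius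
      {F : List (ℕ × ℕ) | IsFrobenius F ∧ (∀ x ∈ F, P ((x.1 : ℤ) - x.2)) ∧
        (F.map fun x => x.1 + x.2 + 1).sum = N}).encard_image]
  have key : ∀ (p : N.Partition) (F : List (ℕ × ℕ)), IsFrobenius F →
      p.parts.sort (· ≥ ·) = partsOfFrobenius F →
      ((∀ j : ℕ, 1 ≤ j → j ≤ durfeeSize p → P (successiveRank p j)) ↔
        ∀ x ∈ F, P ((x.1 : ℤ) - x.2)) := by
    intro p F hF hp
    rw [durfeeSize_eq_length hF hp, List.forall_mem_iff_forall_getElem]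
    constructor
    · intro h m hm
      rw [← successiveRank_eq hF hp m hm]
      exact h _ (by omega) hm
    · intro h j hj1 hj
      obtain ⟨m, rfl⟩ := Nat.exists_eq_add_of_le' hj1
      rw [successiveRank_eq hF hp m hj]
      exact h m hj
  congr 1
  ext l
  constructor
  · rintro ⟨p, hp, rfl⟩
    obtain ⟨F, hF, hFl⟩ := exists_partsOfFrobenius_eq _ (p.parts.sort (· ≥ ·)) le_rfl
      (Multiset.pairwise_sort _ _) (fun y hy => p.parts_pos ((Multiset.mem_sort _).1 hy))
    refine ⟨F, ⟨hF, (key p F hF hFl.symm).1 hp, ?_⟩, hFl⟩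
    rw [← sum_partsOfFrobenius hF, hFl, ← Multiset.sum_coe, Multiset.sort_eq, p.parts_sum]
  · rintro ⟨F, ⟨hF, hP, hN⟩, rfl⟩
    obtain ⟨h1, h2, -⟩ := partsOfFrobenius_bounds hF
    let p : N.Partition :=
      ⟨partsOfFrobenius F, fun {y} hy => h2 y (by simpa using hy), by
        rw [Multiset.sum_coe, sum_partsOfFrobenius hF, hN]⟩
    have hp : p.parts.sort (· ≥ ·) = partsOfFrobenius F := by
      refine List.Perm.eq_of_pairwise' (r := (· ≥ ·)) (Multiset.pairwise_sort _ _) h1 ?_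
      rw [← Multiset.coe_eq_coe, Multiset.sort_eq]
    exact ⟨p, (key p F hF hp).2 hP, hp⟩

/-! ### Jagged partitions as sequences of runs -/

/-- The `t`-th entry of a run at position `p`: runs at even positions are constant, runs at odd
positions alternate between `p / 2` and `p / 2 + 1`. -/
def runEntry (p t : ℕ) : ℕ := p / 2 + if p % 2 = 1 then t % 2 else 0

/-- The jagged sequence whose run at each position `p` with `1 ≤ p ≤ L` has length `g p`. -/
def jaggedOf (g : ℕ → ℕ) : ℕ → List ℕ
  | 0 => []
  | L + 1 => (List.range (g (L + 1))).map (runEntry (L + 1)) ++ jaggedOf g L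

theorem runEntry_ge (p t : ℕ) : p / 2 ≤ runEntry p t := Nat.le_add_right ..

theorem runEntry_le (p t : ℕ) : runEntry p t ≤ (p + 1) / 2 := by
  unfold runEntry
  split_ifs <;> omega

theorem runEntry_of_even {p : ℕ} (hp : p % 2 = 0) (t : ℕ) : runEntry p t = p / 2 := by
  simp [runEntry, hp]

theorem runEntry_of_odd {p : ℕ} (hp : p % 2 = 1) (t : ℕ) : runEntry p t = p / 2 + t % 2 := by
  simp [runEntry, hp]

theorem length_jaggedOf_succ (g : ℕ → ℕ) (L : ℕ) :
    (jaggedOf g (L + 1)).length = g (L + 1) + (jaggedOf g L).length := by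
  simp [jaggedOf]

theorem length_jaggedOf_mono (g : ℕ → ℕ) : Monotone fun L => (jaggedOf g L).length :=
  monotone_nat_of_le_succ fun L => by simp only [length_jaggedOf_succ]; omega

theorem jaggedOf_congr {g h : ℕ → ℕ} : ∀ {L : ℕ}, (∀ p, 1 ≤ p → p ≤ L → g p = h p) →
    jaggedOf g L = jaggedOf h L
  | 0, _ => rfl
  | L + 1, H => by
    rw [jaggedOf, jaggedOf, H (L + 1) (by omega) le_rfl,
      jaggedOf_congr fun p h1 h2 => H p h1 (by omega)]

theorem getElem?_jaggedOf {g : ℕ → ℕ} {p t : ℕ} (hp : 1 ≤ p) (ht : t < g p) : ∀ {L : ℕ}, p ≤ L →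
    (jaggedOf g L)[(jaggedOf g L).length - (jaggedOf g p).length + t]? = some (runEntry p t)
  | 0, h => by omega
  | L + 1, h => by
    rcases h.lt_or_eq with hlt | rfl
    · have hm := length_jaggedOf_mono g (show p ≤ L by omega)
      simp only at hm
      rw [length_jaggedOf_succ, jaggedOf, List.getElem?_append_right (by simp; omega),
        ← getElem?_jaggedOf hp ht (show p ≤ L by omega)]
      congr 1
      simp
      omega
    · rw [Nat.sub_self, zero_add, jaggedOf, List.getElem?_append_left (by simpa using ht)]
      simp [ht]

theorem exists_index_jaggedOf (g : ℕ → ℕ) : ∀ {L j : ℕ}, j < (jaggedOf g L).length →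
    ∃ p t, 1 ≤ p ∧ p ≤ L ∧ t < g p ∧
      j = (jaggedOf g L).length - (jaggedOf g p).length + t
  | 0, j, h => by simp [jaggedOf] at h
  | L + 1, j, h => by
    rw [length_jaggedOf_succ] at h
    by_cases hj : j < g (L + 1)
    · exact ⟨L + 1, j, by omega, le_rfl, hj, by omega⟩
    · obtain ⟨p, t, h1, h2, h3, h4⟩ := exists_index_jaggedOf g (L := L) (j := j - g (L + 1))
        (by omega)
      have hm := length_jaggedOf_mono g h2
      simp only at hm
      refine ⟨p, t, h1, by omega, h3, ?_⟩
      rw [length_jaggedOf_succ]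
      omega

/-- The run at a later position `q` contributes to the length beyond that of `jaggedOf g p`. -/
theorem length_jaggedOf_add_le {g : ℕ → ℕ} {p q : ℕ} (hp : 1 ≤ p) (hq : p < q) :
    (jaggedOf g p).length + g q ≤ (jaggedOf g q).length := by
  obtain ⟨q, rfl⟩ := Nat.exists_eq_add_of_le' (show 1 ≤ q by omega)
  have hm := length_jaggedOf_mono g (show p ≤ q by omega)
  simp only at hm
  rw [length_jaggedOf_succ]
  omega

theorem le_length_jaggedOf {g : ℕ → ℕ} {p : ℕ} (hp : 1 ≤ p) :
    g p ≤ (jaggedOf g p).length := by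
  obtain ⟨p, rfl⟩ := Nat.exists_eq_add_of_le' hp
  rw [length_jaggedOf_succ]
  omega

theorem getElem_jaggedOf {g : ℕ → ℕ} {p t L j : ℕ} (hp : 1 ≤ p) (hpL : p ≤ L) (ht : t < g p)
    (hj : j = (jaggedOf g L).length - (jaggedOf g p).length + t)
    (h : j < (jaggedOf g L).length) : (jaggedOf g L)[j] = runEntry p t := by
  subst hj
  have := getElem?_jaggedOf hp ht hpL
  rw [List.getElem?_eq_getElem h] at this
  exact Option.some.inj this

/-- The runs containing two entries of a jagged sequence. -/
theorem run_le_of_index_lt {g : ℕ → ℕ} {L j j' p p' t t' : ℕ} (hjj : j < j')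
    (hp : 1 ≤ p) (hpL : p ≤ L) (ht' : t' < g p') (hpL' : p' ≤ L)
    (hj : j = (jaggedOf g L).length - (jaggedOf g p).length + t)
    (hj' : j' = (jaggedOf g L).length - (jaggedOf g p').length + t') :
    (p' = p ∧ t' = t + (j' - j)) ∨ p' < p := by
  rcases lt_trichotomy p' p with h | rfl | h
  · exact Or.inr h
  · left
    omega
  · have h1 := length_jaggedOf_add_le (g := g) hp h
    have h2 := length_jaggedOf_mono g hpL'
    simp only at h2
    omega

theorem isJagged_jaggedOf {g : ℕ → ℕ} (hg : ∀ p, p % 2 = 1 → g p % 2 = 0) (L : ℕ) :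
    IsJagged (jaggedOf g L) where
  step_one j h := by
    obtain ⟨p, t, h1, h2, h3, h4⟩ := exists_index_jaggedOf g (L := L) (j := j) (by omega)
    obtain ⟨p', t', h1', h2', h3', h4'⟩ := exists_index_jaggedOf g h
    rw [getElem_jaggedOf h1 h2 h3 h4, getElem_jaggedOf h1' h2' h3' h4']
    have ha := runEntry_ge p t
    have hb := runEntry_le p' t'
    rcases run_le_of_index_lt (by omega) h1 h2 h3' h2' h4 h4' with ⟨rfl, -⟩ | h5 <;> omega
  step_two j h := by
    obtain ⟨p, t, h1, h2, h3, h4⟩ := exists_index_jaggedOf g (L := L) (j := j) (by omega)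
    obtain ⟨p', t', h1', h2', h3', h4'⟩ := exists_index_jaggedOf g h
    rw [getElem_jaggedOf h1 h2 h3 h4, getElem_jaggedOf h1' h2' h3' h4']
    have ha := runEntry_ge p t
    have hb := runEntry_le p' t'
    rcases run_le_of_index_lt (by omega) h1 h2 h3' h2' h4 h4' with ⟨rfl, h5⟩ | h5
    · obtain rfl : t' = t + 2 := by omega
      unfold runEntry
      split_ifs <;> omega
    · omega
  last_pos h := by
    have hpos := List.length_pos_iff.2 h
    obtain ⟨p, t, h1, h2, h3, h4⟩ := exists_index_jaggedOf g (L := L)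
      (j := (jaggedOf g L).length - 1) (by omega)
    rw [List.getLast_eq_getElem, getElem_jaggedOf h1 h2 h3 h4]
    have h5 := le_length_jaggedOf (g := g) h1
    have h6 := length_jaggedOf_mono g h2
    simp only at h6
    unfold runEntry
    split_ifs with hp
    · have := hg p hp
      omega
    · omega

theorem sum_jaggedOf {g : ℕ → ℕ} (hg : ∀ p, p % 2 = 1 → g p % 2 = 0) : ∀ L : ℕ,
    2 * (jaggedOf g L).sum = ∑ p ∈ Finset.range L, (p + 1) * g (p + 1)
  | 0 => by simp [jaggedOf]
  | L + 1 => by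
    have hrun : ∀ p x : ℕ, (p % 2 = 1 → x % 2 = 0) →
        2 * ((List.range x).map (runEntry p)).sum = p * x := by
      intro p x hx
      rcases Nat.mod_two_eq_zero_or_one p with hp | hp
      · have : runEntry p = fun _ => p / 2 := by
          funext t
          simp [runEntry, hp]
        rw [this]
        simp only [List.map_const', List.length_range, List.sum_replicate, smul_eq_mul]
        have : p = 2 * (p / 2) := by omega
        conv_rhs => rw [this]
        ring
      · obtain ⟨y, rfl⟩ : ∃ y, x = 2 * y := ⟨x / 2, by have := hx hp; omega⟩
        obtain ⟨r, rfl⟩ : ∃ r, p = 2 * r + 1 := ⟨p / 2, by omega⟩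
        clear hx
        induction y with
        | zero => simp
        | succ y ih =>
          have e1 : runEntry (2 * r + 1) (2 * y) = r := by
            unfold runEntry; split_ifs <;> omega
          have e2 : runEntry (2 * r + 1) (2 * y + 1) = r + 1 := by
            unfold runEntry; split_ifs <;> omega
          rw [show 2 * (y + 1) = 2 * y + 1 + 1 by ring, List.range_succ, List.range_succ]
          simp only [List.map_append, List.map_cons, List.map_nil, List.sum_append,
            List.sum_cons, List.sum_nil, e1, e2, mul_add, ih]
          ring
    rw [jaggedOf, List.sum_append, mul_add, hrun _ _ (hg _), sum_jaggedOf hg L,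
      Finset.sum_range_succ, add_comm]

/-- If one top run were shorter, lower runs would have to supply its missing entries. For an even
position the first of them is too large to start a lower run; for an odd position the lengths differ
by at least two, and the second missing entry exceeds all lower entries. -/
theorem jaggedOf_injective {g h : ℕ → ℕ} (hg : ∀ p, p % 2 = 1 → g p % 2 = 0)
    (hh : ∀ p, p % 2 = 1 → h p % 2 = 0) : ∀ {L : ℕ}, jaggedOf g L = jaggedOf h L →
    ∀ p, 1 ≤ p → p ≤ L → g p = h p
  | 0, _, p, h1, h2 => by omega
  | L + 1, H, p, h1, h2 => by
    have key : ∀ g h : ℕ → ℕ, (∀ p, p % 2 = 1 → g p % 2 = 0) → (∀ p, p % 2 = 1 → h p % 2 = 0) →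
        jaggedOf g (L + 1) = jaggedOf h (L + 1) → ¬ g (L + 1) < h (L + 1) := by
      intro g h hg hh H hlt
      have hent : ∀ t, g (L + 1) + t < h (L + 1) →
          (jaggedOf g L)[t]? = some (runEntry (L + 1) (g (L + 1) + t)) := by
        intro t ht
        have := getElem?_jaggedOf (p := L + 1) (L := L + 1) (by omega) ht le_rfl
        rw [← H, Nat.sub_self, zero_add, jaggedOf, List.getElem?_append_right (by simp)] at this
        simpa using this
      have hval : ∀ t y, (jaggedOf g L)[t]? = some y →
          ∃ p s, p ≤ L ∧ y = runEntry p s ∧ (t = 0 → s = 0) := by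
        intro t y hy
        obtain ⟨ht, hy⟩ := List.getElem?_eq_some_iff.1 hy
        obtain ⟨p, s, h1, h2, h3, h4⟩ := exists_index_jaggedOf g ht
        refine ⟨p, s, h2, ?_, by omega⟩
        rw [← hy, getElem_jaggedOf h1 h2 h3 h4]
      rcases Nat.mod_two_eq_zero_or_one (L + 1) with hL | hL
      · obtain ⟨p, s, hp, hv, hs⟩ := hval 0 _ (hent 0 (by omega))
        obtain rfl := hs rfl
        unfold runEntry at hv
        split_ifs at hv <;> omega
      · have e1 := hg _ hL
        have e2 := hh _ hL
        obtain ⟨p, s, hp, hv, -⟩ := hval 1 _ (hent 1 (by omega))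
        have := runEntry_le p s
        rw [runEntry_of_odd hL] at hv
        omega
    have hL : g (L + 1) = h (L + 1) :=
      le_antisymm (not_lt.1 (key h g hh hg H.symm)) (not_lt.1 (key g h hg hh H))
    rcases h2.lt_or_eq with hlt | rfl
    · rw [jaggedOf, jaggedOf, hL] at H
      exact jaggedOf_injective hg hh (List.append_cancel_left H) p h1 (by omega)
    · exact hL

theorem IsJagged.tail {a : ℕ} {l : List ℕ} (h : IsJagged (a :: l)) : IsJagged l where
  step_one j hj := h.step_one (j + 1) (by simp only [List.length_cons]; omega)
  step_two j hj := h.step_two (j + 1) (by simp only [List.length_cons]; omega)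
  last_pos hl := by
    have := h.last_pos (by simp)
    simpa [List.getLast_cons, hl] using this

/-- The bounds on the first two entries say that no run above `L` is needed. If they already hold
for the next smaller position, the top run is empty; otherwise the list begins with one entry (even
position) or one pair (odd position) of the top run, which is split off. -/
theorem exists_jaggedOf_eq (L : ℕ) : ∀ (n : ℕ) (l : List ℕ), l.length ≤ n → IsJagged l →
    l.headD 0 ≤ L / 2 → (L % 2 = 0 → l.tail.headD 0 ≤ L / 2) →
    ∃ g : ℕ → ℕ, (∀ p, p % 2 = 1 → g p % 2 = 0) ∧ jaggedOf g L = l := by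
  induction L with
  | zero =>
    intro n l _ hj h1 h2
    refine ⟨fun _ => 0, by simp, ?_⟩
    rcases l with _ | ⟨a, _ | ⟨b, l⟩⟩
    · rfl
    · have := hj.last_pos (by simp)
      simp at this h1
      omega
    · simp at h1 h2
      subst h1 h2
      exact absurd hj (not_isJagged_zero_zero l)
  | succ L ihL =>
    intro n
    induction n with
    | zero =>
      intro l hl _ _ _
      obtain rfl : l = [] := List.length_eq_zero_iff.1 (by omega)
      refine ⟨fun _ => 0, by simp, List.length_eq_zero_iff.1 ?_⟩
      generalize L + 1 = M
      induction M with
      | zero => rfl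
      | succ M ih => rw [length_jaggedOf_succ, ih]
    | succ n ihn =>
      intro l hl hj h1 h2
      by_cases hb : l.headD 0 ≤ L / 2 ∧ (L % 2 = 0 → l.tail.headD 0 ≤ L / 2)
      · obtain ⟨g, hg, hgl⟩ := ihL _ l le_rfl hj hb.1 hb.2
        refine ⟨Function.update g (L + 1) 0, ?_, ?_⟩
        · intro p hp
          by_cases hpL : p = L + 1
          · subst hpL; simp
          · rw [Function.update_of_ne hpL]; exact hg p hp
        · rw [jaggedOf, Function.update_self, List.range_zero, List.map_nil, List.nil_append, ← hgl]
          exact jaggedOf_congr fun p _ hp => Function.update_of_ne (by omega) ..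
      have hext : ∀ (g : ℕ → ℕ) (m : ℕ), (∀ p, p % 2 = 1 → g p % 2 = 0) →
          ((L + 1) % 2 = 1 → m % 2 = 0) →
          ∃ g' : ℕ → ℕ, (∀ p, p % 2 = 1 → g' p % 2 = 0) ∧ jaggedOf g' (L + 1) =
            (List.range (m + g (L + 1))).map (runEntry (L + 1)) ++ jaggedOf g L := by
        intro g m hg hm
        refine ⟨Function.update g (L + 1) (m + g (L + 1)), ?_, ?_⟩
        · intro p hp
          by_cases hpL : p = L + 1
          · subst hpL
            have := hg _ hp
            have := hm hp
            rw [Function.update_self]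
            omega
          · rw [Function.update_of_ne hpL]; exact hg p hp
        · rw [jaggedOf, Function.update_self]
          congr 1
          exact jaggedOf_congr fun p _ hp => Function.update_of_ne (by omega) ..
      rcases Nat.mod_two_eq_zero_or_one L with hL | hL
      · rcases l with _ | ⟨a, _ | ⟨b, l⟩⟩
        · simp at hb
        · simp at hb h1
          omega
        · have hab := hj.step_one 0 (by simp)
          simp at hab h1 hb hl
          obtain ⟨rfl, rfl⟩ : a = L / 2 ∧ b = L / 2 + 1 := by omega
          obtain ⟨g, hg, hgl⟩ := ihn l (by omega) hj.drop_two (by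
            cases l with
            | nil => simp
            | cons c l =>
              have := hj.step_two 0 (by simp)
              simp at this ⊢
              omega) (by omega)
          obtain ⟨g', hg', hgl'⟩ := hext g 2 hg (by omega)
          refine ⟨g', hg', ?_⟩
          have e : ∀ t, runEntry (L + 1) (2 + t) = runEntry (L + 1) t := by
            intro t; unfold runEntry; split_ifs <;> omega
          have e0 : runEntry (L + 1) 0 = L / 2 := by
            unfold runEntry; split_ifs <;> omega
          have e1 : runEntry (L + 1) 1 = L / 2 + 1 := by
            unfold runEntry; split_ifs <;> omega
          rw [hgl', ← hgl, List.range_add, List.map_append, List.map_map, jaggedOf]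
          have : (runEntry (L + 1) ∘ fun t => 2 + t) = runEntry (L + 1) := funext e
          rw [this]
          simp [List.range_succ, e0, e1]
      · rcases l with _ | ⟨a, l⟩
        · simp [hL] at hb
        · simp [hL] at hb h1 hl
          have hsnd := h2 (by omega)
          simp at hsnd
          obtain rfl : a = (L + 1) / 2 := by omega
          obtain ⟨g, hg, hgl⟩ := ihn l hl hj.tail (by
            simpa using hsnd) (by
            intro _
            rcases l with _ | ⟨c, _ | ⟨d, l⟩⟩
            · simp
            · simp
            · have := hj.step_two 0 (by simp)
              simpa using this)
          obtain ⟨g', hg', hgl'⟩ := hext g 1 hg (by omega)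
          refine ⟨g', hg', ?_⟩
          have e : ∀ t, runEntry (L + 1) t = (L + 1) / 2 := by
            intro t; unfold runEntry; split_ifs <;> omega
          have : (runEntry (L + 1) ∘ fun t => 1 + t) = runEntry (L + 1) := by
            funext t; simp [e]
          rw [hgl', ← hgl, List.range_add, List.map_append, List.map_map, jaggedOf, this]
          simp [e]

theorem pairCount_jaggedOf {g : ℕ → ℕ} (hg : ∀ p, p % 2 = 1 → g p % 2 = 0) {L : ℕ} (hL : 1 ≤ L) :
    pairCount (jaggedOf g L) = g 1 / 2 := by
  have h1 := hg 1 rfl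
  have hl1 := le_length_jaggedOf (g := g) le_rfl
  have hl1' : (jaggedOf g 1).length = g 1 := by simp [jaggedOf]
  have hmono := length_jaggedOf_mono g hL
  simp only at hmono
  set B := (jaggedOf g L).length - (jaggedOf g 1).length with hB
  rw [pairCount, show (Finset.range (jaggedOf g L).length).filter
      (fun j => (jaggedOf g L)[j]? = some 0 ∧ (jaggedOf g L)[j + 1]? = some 1) =
      (Finset.range (g 1 / 2)).image (fun s => B + 2 * s) from ?_,
    Finset.card_image_of_injective _ (fun a b h => by simp at h; exact h), Finset.card_range]
  ext j
  simp only [Finset.mem_filter, Finset.mem_range, Finset.mem_image]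
  constructor
  · rintro ⟨hj, h0, -⟩
    obtain ⟨p, t, hp, hpL, ht, hjt⟩ := exists_index_jaggedOf g hj
    rw [hjt, getElem?_jaggedOf hp ht hpL, Option.some.injEq] at h0
    unfold runEntry at h0
    obtain rfl : p = 1 := by omega
    rw [if_pos rfl] at h0
    exact ⟨t / 2, by omega, by omega⟩
  · rintro ⟨s, hs, rfl⟩
    refine ⟨by omega, ?_, ?_⟩
    · rw [hB, getElem?_jaggedOf le_rfl (by omega) hL]
      simp [runEntry]
    · rw [hB, add_assoc, getElem?_jaggedOf le_rfl (by omega) hL]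
      simp [runEntry]

/-- Two neighbouring runs hold fewer than `K` entries, so the ends of a window of `K` entries lie at
least two positions apart. -/
theorem isRestricted_jaggedOf {g : ℕ → ℕ} (hg : ∀ p, p % 2 = 1 → g p % 2 = 0) {L K : ℕ}
    (hK : ∀ p, 1 ≤ p → p ≤ L → g p + g (p + 1) + 1 ≤ K) :
    IsRestricted K (jaggedOf g L) := by
  intro j hK2 hj
  obtain ⟨p, t, h1, h2, h3, h4⟩ := exists_index_jaggedOf g (L := L) (j := j) (by omega)
  obtain ⟨p', t', h1', h2', h3', h4'⟩ := exists_index_jaggedOf g hj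
  have hlp := length_jaggedOf_mono g h2
  have hlp' := length_jaggedOf_mono g h2'
  simp only at hlp hlp'
  have hKp := hK p h1 h2
  have hKp' := hK p' h1' h2'
  rw [getElem_jaggedOf h1 h2 h3 h4, getElem_jaggedOf h1' h2' h3' h4']
  rcases run_le_of_index_lt (by omega) h1 h2 h3' h2' h4 h4' with ⟨rfl, h5⟩ | h5
  · omega
  rcases (show p' + 1 = p ∨ p' + 2 = p ∨ p' + 3 ≤ p by omega) with rfl | rfl | h6
  · have := length_jaggedOf_succ g p'
    omega
  · rcases Nat.mod_two_eq_zero_or_one p' with hp | hp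
    · left
      unfold runEntry
      split_ifs <;> omega
    -- Between odd runs two positions apart the drop of one fails only from a lower entry to an
    -- upper entry; as runs are made of whole pairs, this is the exceptional alternative of the
    -- restriction.
    · have hp2 : (p' + 2) % 2 = 1 := by omega
      have e1 := hg _ hp
      have e2 := hg _ hp2
      by_cases ht : t % 2 = 0 ∧ t' % 2 = 1
      · right
        rw [getElem_jaggedOf (t := t + 1) h1 h2 (by omega) (by omega) (by omega),
          getElem_jaggedOf (t := t' - 1) h1' h2' (by omega) (by omega) (by omega)]
        simp only [runEntry_of_odd hp, runEntry_of_odd hp2]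
        omega
      · left
        simp only [runEntry_of_odd hp, runEntry_of_odd hp2]
        omega
  · left
    have := runEntry_ge p t
    have := runEntry_le p' t'
    omega

theorem le_of_isRestricted_jaggedOf {g : ℕ → ℕ} (hg : ∀ p, p % 2 = 1 → g p % 2 = 0) {L K : ℕ}
    (hK : 2 < K) (hgL : g (L + 1) = 0) (h : IsRestricted K (jaggedOf g L)) {p : ℕ}
    (hp : 1 ≤ p) (hpL : p ≤ L) : g p + g (p + 1) + 1 ≤ K := by
  by_contra hlt
  have hlp := length_jaggedOf_mono g hpL
  have hlp1 := length_jaggedOf_succ g p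
  have hp1 : (jaggedOf g (p + 1)).length ≤ (jaggedOf g L).length := by
    rcases hpL.lt_or_eq with h | rfl
    · exact length_jaggedOf_mono g h
    · omega
  have hp0 := le_length_jaggedOf (g := g) hp
  simp only at hlp
  obtain ⟨B, hB⟩ := Nat.exists_eq_add_of_le' hp1
  have hW : ∀ u, u < g (p + 1) + g p → ∀ (hu : B + u < (jaggedOf g L).length),
      (jaggedOf g L)[B + u] =
        if u < g (p + 1) then runEntry (p + 1) u else runEntry p (u - g (p + 1)) := by
    intro u hu hu'
    split_ifs with h1
    · have : p + 1 ≤ L := by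
        by_contra hc
        obtain rfl : p = L := by omega
        omega
      exact getElem_jaggedOf (by omega) this h1 (by omega) _
    · exact getElem_jaggedOf hp hpL (by omega) (by omega) _
  rcases Nat.mod_two_eq_zero_or_one p with hpar | hpar
  -- For even `p` the window starts where the two runs start, at their minimum `p / 2`; both
  -- alternatives would need a smaller entry later.
  · have hq : (p + 1) % 2 = 1 := by omega
    have hge : ∀ u, u < g (p + 1) + g p → ∀ (hu : B + u < (jaggedOf g L).length),
        p / 2 ≤ (jaggedOf g L)[B + u] := by
      intro u hu hu'
      rw [hW u hu hu']
      have := runEntry_ge (p + 1) u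
      have := runEntry_ge p (u - g (p + 1))
      split_ifs <;> omega
    have h0 : ∀ (hu : B + 0 < (jaggedOf g L).length), (jaggedOf g L)[B + 0] = p / 2 := by
      intro hu
      rw [hW 0 (by omega) hu]
      rw [runEntry_of_odd hq, runEntry_of_even hpar]
      split_ifs <;> omega
    have hr := h B (by omega) (by omega)
    have a0 := h0 (by omega)
    simp only [add_zero] at a0
    have a1 := hge (K - 1) (by omega) (by omega)
    have a2 := hge (K - 2) (by omega) (by omega)
    omega
  -- For odd `p` the window ends where the two runs end, at their maximum `(p + 1) / 2`; both
  -- alternatives would need a larger entry earlier.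
  · have hq : (p + 1) % 2 = 0 := by omega
    have hgp := hg p hpar
    obtain ⟨j, hj⟩ : ∃ j, j + K = g (p + 1) + g p := ⟨g (p + 1) + g p - K, by omega⟩
    have hle : ∀ u, u < g (p + 1) + g p → ∀ (hu : B + u < (jaggedOf g L).length),
        (jaggedOf g L)[B + u] ≤ (p + 1) / 2 := by
      intro u hu hu'
      rw [hW u hu hu']
      rw [runEntry_of_even hq, runEntry_of_odd hpar]
      split_ifs <;> omega
    have hend : ∀ (hu : B + (j + (K - 1)) < (jaggedOf g L).length),
        (jaggedOf g L)[B + (j + (K - 1))] = (p + 1) / 2 := by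
      intro hu
      rw [hW _ (by omega) hu]
      rw [runEntry_of_even hq, runEntry_of_odd hpar]
      split_ifs <;> omega
    have hr := h (B + j) (by omega) (by omega)
    have a0 := hend (by omega)
    have a1 := hle j (by omega) (by omega)
    have a2 := hle (j + 1) (by omega) (by omega)
    simp only [← add_assoc] at a0 a2
    omega

/-! ### Jagged partitions as frequency lists -/

/-- The frequency list, of positions `1, …, M`, of a function. -/
def freqList (g : ℕ → ℕ) (M : ℕ) : List ℕ := (List.range M).map fun q => g (q + 1)

/-- The frequency at a position, as a function. -/
def freqAt (f : List ℕ) (p : ℕ) : ℕ := if p = 0 then 0 else f.getD (p - 1) 0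

theorem freqAt_freqList {g : ℕ → ℕ} {M p : ℕ} (hp : 1 ≤ p) (hpM : p ≤ M) :
    freqAt (freqList g M) p = g p := by
  obtain ⟨q, rfl⟩ := Nat.exists_eq_add_of_le' hp
  simp [freqAt, freqList, show q < M by omega]

theorem length_freqList (g : ℕ → ℕ) (M : ℕ) : (freqList g M).length = M := by
  simp [freqList]

/-- Frequencies outside the dominoes vanish, hence are even; so for `c = 0` the parity condition
extends to all odd positions. -/
theorem parityFrom_zero_iff : ∀ (f : List ℕ) (p : ℕ),
    ParityFrom 0 p f ↔ ∀ q, (p + q) % 2 = 1 → f.getD q 0 % 2 = 0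
  | [], p => by simp [ParityFrom]
  | x :: f, p => by
    have hx : (topHead (x :: f) = true ∨ topHead f = true → x % 2 = 0) ↔ x % 2 = 0 := by
      rcases Nat.eq_zero_or_pos x with rfl | hx
      · simp
      · cases h : topHead f <;> simp [topHead, hx, h]
    rw [ParityFrom, hx, parityFrom_zero_iff f (p + 1)]
    constructor
    · rintro ⟨h1, h2⟩ (_ | q) hq
      · simpa using h1 hq
      · simpa using h2 q (by omega)
    · intro h
      exact ⟨fun hp => by simpa using h 0 hp, fun q hq => by simpa using h (q + 1) (by omega)⟩

theorem gordon_iff {k : ℕ} : ∀ f : List ℕ,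
    Gordon k f ↔ ∀ q, q < f.length → f.getD q 0 + f.getD (q + 1) 0 + 1 ≤ k
  | [] => by simp [Gordon]
  | x :: f => by
    have hx : f.headD 0 = f.getD 0 0 := by cases f <;> simp
    rw [Gordon, gordon_iff f, hx]
    constructor
    · rintro ⟨h1, h2⟩ (_ | q) hq
      · simpa using h1
      · simpa using h2 q (by simpa using hq)
    · intro h
      exact ⟨by simpa using h 0 (by simp), fun q hq => by simpa using h (q + 1) (by simpa using hq)⟩

theorem weightFrom_eq_sum : ∀ (f : List ℕ) (p : ℕ),
    weightFrom p f = ∑ q ∈ Finset.range f.length, (p + q) * f.getD q 0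
  | [], p => by simp [weightFrom]
  | x :: f, p => by
    rw [weightFrom, weightFrom_eq_sum f (p + 1), List.length_cons, Finset.sum_range_succ']
    simp only [List.getD_cons_succ, List.getD_cons_zero, add_zero]
    rw [add_comm]
    congr 1
    exact Finset.sum_congr rfl fun q _ => by ring

theorem freqAt_odd {f : List ℕ} (h : ParityFrom 0 1 f) (p : ℕ) (hp : p % 2 = 1) :
    freqAt f p % 2 = 0 := by
  rw [freqAt, if_neg (by omega)]
  exact (parityFrom_zero_iff f 1).1 h (p - 1) (by omega)

theorem two_mul_sum_jaggedOf_freqAt {f : List ℕ} (h : ParityFrom 0 1 f) :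
    2 * (jaggedOf (freqAt f) f.length).sum = weightFrom 1 f := by
  rw [sum_jaggedOf (freqAt_odd h), weightFrom_eq_sum]
  exact Finset.sum_congr rfl fun q _ => by simp [freqAt, add_comm]

theorem isRestricted_freqAt_iff {f : List ℕ} (h : ParityFrom 0 1 f) {K : ℕ} (hK : 2 < K) :
    IsRestricted K (jaggedOf (freqAt f) f.length) ↔ Gordon K f := by
  rw [gordon_iff]
  constructor
  · intro hr q hq
    have := le_of_isRestricted_jaggedOf (freqAt_odd h) hK (by simp [freqAt]) hr
      (p := q + 1) (by omega) hq
    simpa [freqAt] using this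
  · intro hg
    refine isRestricted_jaggedOf (freqAt_odd h) fun p hp hpL => ?_
    obtain ⟨q, rfl⟩ := Nat.exists_eq_add_of_le' hp
    simpa [freqAt] using hg q hpL

theorem pairCount_freqAt {f : List ℕ} (h : ParityFrom 0 1 f) :
    pairCount (jaggedOf (freqAt f) f.length) = f.headD 0 / 2 := by
  cases f with
  | nil => simp [jaggedOf, pairCount]
  | cons x f =>
    rw [pairCount_jaggedOf (freqAt_odd h) (by simp)]
    simp [freqAt]

theorem jaggedOf_freqAt_injOn (M : ℕ) :
    Set.InjOn (fun f => jaggedOf (freqAt f) M) {f | f.length = M ∧ ParityFrom 0 1 f} := by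
  rintro f ⟨hf, hfp⟩ g ⟨hg, hgp⟩ h
  have key := jaggedOf_injective (freqAt_odd hfp) (freqAt_odd hgp) h
  refine List.ext_getElem (by rw [hf, hg]) fun q h1 h2 => ?_
  have := key (q + 1) (by omega) (by omega)
  simpa [freqAt, h1, h2] using this

theorem IsJagged.le_two_mul_sum {l : List ℕ} (h : IsJagged l) :
    l.headD 0 ≤ l.sum ∧ l.tail.headD 0 ≤ l.sum := by
  rcases l with _ | ⟨a, _ | ⟨b, l⟩⟩
  · simp
  · simp
  · simp
    omega

theorem jaggedSet_eq_image {K i n : ℕ} (hK : 2 < K) (hi : 1 ≤ i) :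
    jaggedSet K i n = (fun f => jaggedOf (freqAt f) (2 * n)) ''
      {f | f.length = 2 * n ∧ Gordon K f ∧ f.headD 0 < 2 * i - 1 ∧ ParityFrom 0 1 f ∧
        weightFrom 1 f = 2 * n} := by
  have hhead : ∀ f : List ℕ, ParityFrom 0 1 f →
      (f.headD 0 / 2 ≤ i - 1 ↔ f.headD 0 < 2 * i - 1) := by
    intro f hf
    have h := (parityFrom_zero_iff f 1).1 hf 0 rfl
    have hx : f.headD 0 = f.getD 0 0 := by cases f <;> simp
    rw [← hx] at h
    omega
  have key : ∀ f : List ℕ, f.length = 2 * n → ParityFrom 0 1 f →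
      (jaggedOf (freqAt f) (2 * n) ∈ jaggedSet K i n ↔
        Gordon K f ∧ f.headD 0 < 2 * i - 1 ∧ weightFrom 1 f = 2 * n) := by
    intro f hf hp
    have hs := two_mul_sum_jaggedOf_freqAt hp
    have hr := isRestricted_freqAt_iff hp hK
    have hc := pairCount_freqAt hp
    rw [hf] at hs hr hc
    rw [jaggedSet, Set.mem_ofPred_eq, hr, hc, hhead f hp, ← hs]
    have := isJagged_jaggedOf (freqAt_odd hp) (2 * n)
    constructor
    · rintro ⟨-, h1, h2, h3⟩
      exact ⟨h1, h3, by rw [h2]⟩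
    · rintro ⟨h1, h2, h3⟩
      exact ⟨this, h1, by omega, h2⟩
  ext l
  constructor
  · intro hl
    obtain ⟨h1, h2⟩ := hl.1.le_two_mul_sum
    -- The first two entries are at most `n`, so positions up to `2 * n` suffice.
    obtain ⟨g, hg, rfl⟩ := exists_jaggedOf_eq (2 * n) _ l le_rfl hl.1
      (by rw [hl.2.2.1] at h1; omega) (by rw [hl.2.2.1] at h2; omega)
    have hgf : jaggedOf (freqAt (freqList g (2 * n))) (2 * n) = jaggedOf g (2 * n) :=
      jaggedOf_congr fun p h1 h2 => freqAt_freqList h1 h2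
    have hp : ParityFrom 0 1 (freqList g (2 * n)) := by
      rw [parityFrom_zero_iff]
      intro q hq
      by_cases hqn : q < 2 * n
      · have := freqAt_freqList (g := g) (M := 2 * n) (p := q + 1) (by omega) hqn
        simp only [freqAt, Nat.add_sub_cancel] at this
        rw [if_neg (by omega)] at this
        rw [this]
        exact hg _ (by omega)
      · rw [List.getD_eq_default _ _ (by rw [length_freqList]; omega)]
    have hlen := length_freqList g (2 * n)
    have := (key _ hlen hp).1 (by rw [hgf]; exact hl)
    exact ⟨freqList g (2 * n), ⟨hlen, this.1, this.2.1, hp, this.2.2⟩, hgf⟩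
  · rintro ⟨f, ⟨h1, h2, h3, h4, h5⟩, rfl⟩
    exact (key f h1 h4).2 ⟨h2, h3, h5⟩

theorem encard_jaggedSet {K i n : ℕ} (hK : 2 < K) (hi : 1 ≤ i) :
    (jaggedSet K i n).encard = {f : List ℕ | f.length = 2 * n ∧ Gordon K f ∧
      f.headD 0 < 2 * i - 1 ∧ ParityFrom 0 1 f ∧ weightFrom 1 f = 2 * n}.encard := by
  rw [jaggedSet_eq_image hK hi]
  refine Set.InjOn.encard_image (Set.InjOn.mono ?_ (jaggedOf_freqAt_injOn (2 * n)))
  rintro f ⟨h1, -, -, h2, -⟩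
  exact ⟨h1, h2⟩

/-! ### Summation over the refinement and conclusion -/

theorem encard_lt_succ {γ : Type*} (C : Set γ) (φ : γ → ℕ) (m : ℕ) :
    {x | x ∈ C ∧ φ x < m + 1}.encard =
      {x | x ∈ C ∧ φ x < m}.encard + {x | x ∈ C ∧ φ x = m}.encard := by
  rw [← Set.encard_union_eq]
  · congr 1
    ext x
    simp only [Set.mem_union, Set.mem_ofPred_eq, ← and_or_left, Nat.lt_succ_iff_lt_or_eq]
  · rw [Set.disjoint_left]
    rintro x ⟨-, h1⟩ ⟨-, h2⟩
    omega

theorem encard_eq_of_fibers {α β : Type*} {A : Set α} {B : Set β} (δ : α → ℕ) (ε : β → ℕ)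
    (h : ∀ d, {x | x ∈ A ∧ δ x = d}.encard = {y | y ∈ B ∧ ε y = d}.encard) {D : ℕ}
    (hA : ∀ x ∈ A, δ x < D) (hB : ∀ y ∈ B, ε y < D) : A.encard = B.encard := by
  have key : ∀ m, {x | x ∈ A ∧ δ x < m}.encard = {y | y ∈ B ∧ ε y < m}.encard := by
    intro m
    induction m with
    | zero => simp
    | succ m ih => rw [encard_lt_succ, encard_lt_succ, ih, h]
  convert key D using 2
  · ext x; exact ⟨fun hx => ⟨hx, hA x hx⟩, fun hx => hx.1⟩
  · ext x; exact ⟨fun hx => ⟨hx, hB x hx⟩, fun hx => hx.1⟩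

theorem encard_gordon_eq_frobenius {k a : ℕ} (hk : 1 ≤ k) (ha : 1 ≤ a) (hak : a ≤ k) {c : ℕ}
    (hc : c ≤ 1) (N : ℕ) :
    {f : List ℕ | f.length = N ∧ Gordon k f ∧ f.headD 0 < a ∧ ParityFrom c 1 f ∧
        weightFrom 1 f = N}.encard =
      {F : List (ℕ × ℕ) | IsFrobenius F ∧ (∀ x ∈ F, 2 - (a : ℤ) ≤ (x.1 : ℤ) - x.2 ∧
        (x.1 : ℤ) - x.2 ≤ 2 * k - a - 1 ∧ (x.1 + x.2 + 1) % 2 = c) ∧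
        (F.map fun x => x.1 + x.2 + 1).sum = N}.encard := by
  refine encard_eq_of_fibers topCount List.length (D := N + 1) (fun d => ?_) ?_ ?_
  · have key := fun u => encard_gordonSet_eq_frobeniusSet hk N N d c a u le_rfl hc ha hak
    have h := congrArg₂ (· + ·) (key true) (key false)
    rw [← Set.encard_union_eq (disjoint_gordonSet ..),
      ← Set.encard_union_eq (disjoint_frobeniusSet ..)] at h
    convert h using 2
    · ext f
      simp only [gordonSet, Set.mem_union, Set.mem_ofPred_eq]
      cases topHead f <;> simp [and_assoc]
    · ext F
      simp only [frobeniusSet, Set.mem_union, Set.mem_ofPred_eq]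
      by_cases hF : ∃ x ∈ F, x.1 = 0 <;> simp only [hF] <;> simp [and_assoc]
  · rintro f ⟨-, -, -, -, h⟩
    have := topCount_le_weightFrom f 0
    rw [zero_add] at this
    omega
  · rintro F ⟨-, -, h⟩
    have := length_le_sum_hooks F
    omega

theorem proposition6 (K i κ ε : ℕ) (hK : 2 < K) (hε : ε = 0 ∨ ε = 1)
    (hκ : (K : ℤ) = 2 * (κ : ℤ) - (ε : ℤ)) (hi : 1 ≤ i) (hiκ : i ≤ κ) (n : ℕ) :
    jaggedCount K i n = rankCount K i (2 * n) := by
  have hiK : 2 * i - 1 ≤ K := by omega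
  have h1 := encard_setOf_successiveRank (2 * n) fun r =>
    Odd r ∧ r ∈ Set.Icc (3 - 2 * (i : ℤ)) (2 * (K : ℤ) - 1 - 2 * (i : ℤ))
  have h2 := encard_gordon_eq_frobenius (show 1 ≤ K by omega) (show 1 ≤ 2 * i - 1 by omega) hiK
    zero_le_one (2 * n)
  rw [jaggedCount, rankCount, ← Set.coe_ofPred, Nat.card_coe_set_eq, Set.ncard_def, Set.ncard_def,
    encard_jaggedSet hK hi, h2, h1]
  congr 3
  ext F
  refine and_congr_right fun _ => and_congr_left fun _ => forall₂_congr fun x _ => ?_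
  rw [Int.odd_iff, Set.mem_Icc]
  -- With `a = 2i - 1` the upper bound `2k - a - 1` is `2K - 2i`; being even, it is never an odd
  -- rank, so it may be replaced by `2K - 1 - 2i`.
  omega
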